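/- Let $n\ge 2$ and let $M$ be a smooth $2n$-dimensional manifold with a special almost Hermitian structure (an $\mathrm{SU}(n)$-structure): a Riemannian metric $\langle\cdot,\cdot\rangle$, an orthogonal almost complex structure $I$, with Kähler form $\omega(X,Y)=\langle X,IY\rangle$, and a complex volume form $\Psi$, i.e. a smooth complex-valued $n$-form that is complex multilinear on $(TM,I)$ and satisfies $\langle\Psi,\Psi\rangle_{\mathbb C}=\frac1{n!}\sum_{i_1,\dots,i_n=1}^n|\Psi(u_{i_1},\dots,u_{i_n})|^2=1$ for unitary bases $u_1,\dots,u_n$. Let $\nabla$ be the Levi-Civita connection and $R_{X,Y}=\nabla_{[X,Y]}-[\nabla_X,\nabla_Y]$, and put, for an orthonormal basis $(e_i)$, $$\mathrm{Ric}(X,Y)=\sum_i\langle R_{X,e_i}Y,e_i\rangle,\qquad \mathrm{Ric}^*(X,Y)=\sum_i\langle R_{X,e_i}IY,Ie_i\rangle .$$ Let $\overline\nabla$ be the minimal $\mathrm{SU}(n)$-connection, i.e. the unique connection with $\overline\nabla\langle\cdot,\cdot\rangle=0$, $\overline\nabla I=0$, $\overline\nabla\Psi=0$ such that $\overline\nabla_X-\nabla_X$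 lies in the orthogonal complement $\mathfrak{su}(n)^\perp=\mathbb R\,\omega\oplus\mathfrak u(n)^\perp$ of $\mathfrak{su}(n)$ in $\mathfrak{so}(2n)$ for all $X$. Let $\hat\eta$ be the one-form such that the $\mathbb R\,\omega$-component of $\overline\nabla_X-\nabla_X$ is $Y\mapsto\hat\eta(X)\,IY$. Suppose that $M$ is Kähler, i.e. $\nabla I=0$. Then $\mathrm{Ric}^*=\mathrm{Ric}$, and: 1. if $d\hat\eta=\lambda\omega$ for some constant $\lambda\in\mathbb R\setminus\{0\}$, then $M$ is Einstein, i.e. $\mathrm{Ric}=c\,\langle\cdot,\cdot\rangle$ for a constant $c\in\mathbb R$; 2. if $\hat\eta$ is closed, then $M$ is Ricci-flat, i.e. $\mathrm{Ric}=0$. -/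

import Mathlib

open Bundle FiberBundle VectorField Module
open scoped Manifold ContDiff Topology

noncomputable section

section LeviCivita

variable {E : Type*} [NormedAddCommGroup E] [NormedSpace ℝ E] [FiniteDimensional ℝ E]
  {M : Type*} [TopologicalSpace M] [ChartedSpace E M] [IsManifold 𝓘(ℝ, E) ∞ M]

instance tangentSpace_finiteDimensional (x : M) :
    FiniteDimensional ℝ (TangentSpace 𝓘(ℝ, E) x) :=
  inferInstanceAs (FiniteDimensional ℝ E)

variable [RiemannianBundle (fun x : M ↦ TangentSpace 𝓘(ℝ, E) x)]

/-- Half of the right-hand side of the Koszul formula. -/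
def koszul (X Y Z : Π x : M, TangentSpace 𝓘(ℝ, E) x) (x : M) : ℝ :=
  (1 / 2 : ℝ) *
    (d% (fun y ↦ inner ℝ (Y y) (Z y)) x (X x)
      + d% (fun y ↦ inner ℝ (Z y) (X y)) x (Y x)
      - d% (fun y ↦ inner ℝ (X y) (Y y)) x (Z x)
      + inner ℝ (mlieBracket 𝓘(ℝ, E) X Y x) (Z x)
      - inner ℝ (mlieBracket 𝓘(ℝ, E) Y Z x) (X x)
      + inner ℝ (mlieBracket 𝓘(ℝ, E) Z X x) (Y x))

variable [IsContMDiffRiemannianBundle 𝓘(ℝ, E) ∞ E (fun x : M ↦ TangentSpace 𝓘(ℝ, E) x)]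


variable {X X' Y Y' Z Z' : Π x : M, TangentSpace 𝓘(ℝ, E) x} {x : M}

set_option linter.unusedSectionVars false in
theorem mdiffAt_inner (hY : MDiffAt (T% Y) x) (hZ : MDiffAt (T% Z) x) :
    MDiffAt (fun y ↦ inner ℝ (Y y) (Z y)) x :=
  MDifferentiableAt.inner_bundle (E := fun x : M ↦ TangentSpace 𝓘(ℝ, E) x) (b := fun y ↦ y) hY hZ

theorem koszul_tensorial_right (hX : MDiffAt (T% X) x) (hY : MDiffAt (T% Y) x) :
    TensorialAt 𝓘(ℝ, E) E (fun Z ↦ koszul X Y Z x) x where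
  smul {f Z} hf hZ := by
    simp [koszul, mlieBracket_smul_left hf hZ, mlieBracket_smul_right hf hZ,
      inner_add_left, inner_smul_left, inner_smul_right,
      mvfderiv_fun_mul hf (mdiffAt_inner hY hZ), mvfderiv_fun_mul hf (mdiffAt_inner hZ hX)]
    rw [real_inner_comm (Y x) (Z x)]
    ring
  add {Z Z'} hZ hZ' := by
    simp [koszul, mlieBracket_add_left hZ hZ', mlieBracket_add_right hZ hZ',
      inner_add_left, inner_add_right,
      mvfderiv_fun_add (mdiffAt_inner hY hZ) (mdiffAt_inner hY hZ'),
      mvfderiv_fun_add (mdiffAt_inner hZ hX) (mdiffAt_inner hZ' hX)]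
    ring

theorem koszul_tensorial_left (hY : MDiffAt (T% Y) x) (hZ : MDiffAt (T% Z) x) :
    TensorialAt 𝓘(ℝ, E) E (fun X ↦ koszul X Y Z x) x where
  smul {f X} hf hX := by
    simp [koszul, mlieBracket_smul_left hf hX, mlieBracket_smul_right hf hX,
      inner_add_left, inner_smul_left, inner_smul_right,
      mvfderiv_fun_mul hf (mdiffAt_inner hX hY), mvfderiv_fun_mul hf (mdiffAt_inner hZ hX)]
    rw [real_inner_comm (Z x) (X x)]
    ring
  add {X X'} hX hX' := by
    simp [koszul, mlieBracket_add_left hX hX', mlieBracket_add_right hX hX',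
      inner_add_left, inner_add_right,
      mvfderiv_fun_add (mdiffAt_inner hX hY) (mdiffAt_inner hX' hY),
      mvfderiv_fun_add (mdiffAt_inner hZ hX) (mdiffAt_inner hZ hX')]
    ring

theorem koszul_add_mid (hX : MDiffAt (T% X) x) (hY : MDiffAt (T% Y) x) (hY' : MDiffAt (T% Y') x)
    (hZ : MDiffAt (T% Z) x) :
    koszul X (Y + Y') Z x = koszul X Y Z x + koszul X Y' Z x := by
  simp [koszul, mlieBracket_add_left hY hY', mlieBracket_add_right hY hY',
      inner_add_left, inner_add_right,
      mvfderiv_fun_add (mdiffAt_inner hY hZ) (mdiffAt_inner hY' hZ),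
      mvfderiv_fun_add (mdiffAt_inner hX hY) (mdiffAt_inner hX hY')]
  ring

theorem koszul_smul_mid {f : M → ℝ} (hf : MDiffAt f x) (hX : MDiffAt (T% X) x)
    (hY : MDiffAt (T% Y) x) (hZ : MDiffAt (T% Z) x) :
    koszul X (f • Y) Z x = f x * koszul X Y Z x + d% f x (X x) * inner ℝ (Y x) (Z x) := by
  simp [koszul, mlieBracket_smul_left hf hY, mlieBracket_smul_right hf hY,
      inner_add_left, inner_smul_left, inner_smul_right,
      mvfderiv_fun_mul hf (mdiffAt_inner hY hZ), mvfderiv_fun_mul hf (mdiffAt_inner hX hY)]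
  rw [real_inner_comm (X x) (Y x)]
  ring

/-- For a vector field `Y` differentiable at `x`, the bilinear form `(X, Z) ↦ ⟨∇_X Y, Z⟩` at `x`. -/
def koszulForm (hY : MDiffAt (T% Y) x) :
    TangentSpace 𝓘(ℝ, E) x →L[ℝ] TangentSpace 𝓘(ℝ, E) x →L[ℝ] ℝ :=
  TensorialAt.mkHom₂ (fun X Z ↦ koszul X Y Z x) x
    (fun _ hZ ↦ koszul_tensorial_left hY hZ) (fun _ hX ↦ koszul_tensorial_right hX hY)

open Classical in
/-- The Levi-Civita connection as a map on vector fields, determined by the Koszul formula;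
it takes the value `0` at points where `Y` is not differentiable. -/
def leviCivitaFun (Y : Π x : M, TangentSpace 𝓘(ℝ, E) x) (x : M) :
    TangentSpace 𝓘(ℝ, E) x →L[ℝ] TangentSpace 𝓘(ℝ, E) x :=
  if hY : MDiffAt (T% Y) x then
    ∑ i, ((koszulForm hY).flip (stdOrthonormalBasis ℝ (TangentSpace 𝓘(ℝ, E) x) i)).smulRight
      (stdOrthonormalBasis ℝ (TangentSpace 𝓘(ℝ, E) x) i)
  else 0

theorem inner_leviCivitaFun (hX : MDiffAt (T% X) x) (hY : MDiffAt (T% Y) x)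
    (hZ : MDiffAt (T% Z) x) :
    inner ℝ (leviCivitaFun Y x (X x)) (Z x) = koszul X Y Z x := by
  have h : koszulForm hY (X x) (Z x) = koszul X Y Z x :=
    TensorialAt.mkHom₂_apply (Φ := fun X Z ↦ koszul X Y Z x) _ _ hX hZ
  rw [← h, leviCivitaFun, dif_pos hY]
  conv_rhs => rw [← (stdOrthonormalBasis ℝ (TangentSpace 𝓘(ℝ, E) x)).sum_repr' (Z x)]
  simp [sum_inner, inner_smul_left, mul_comm]

theorem leviCivitaFun_isCovariantDerivativeOn :
    IsCovariantDerivativeOn E (leviCivitaFun (E := E) (M := M)) Set.univ where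
  add {Y Y' x} hY hY' _ := by
    ext v
    refine ext_inner_right ℝ fun w ↦ ?_
    have hv := mdifferentiableAt_extend 𝓘(ℝ, E) E v
    have hw := mdifferentiableAt_extend 𝓘(ℝ, E) E w
    have h := koszul_add_mid hv hY hY' hw
    rw [← inner_leviCivitaFun hv hY hw, ← inner_leviCivitaFun hv hY' hw,
      ← inner_leviCivitaFun hv (mdifferentiableAt_add_section hY hY') hw] at h
    simpa [inner_add_left] using h
  leibniz {Y f x} hY hf _ := by
    ext v
    refine ext_inner_right ℝ fun w ↦ ?_
    have hv := mdifferentiableAt_extend 𝓘(ℝ, E) E v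
    have hw := mdifferentiableAt_extend 𝓘(ℝ, E) E w
    have h := koszul_smul_mid hf hv hY hw
    rw [← inner_leviCivitaFun hv hY hw,
      ← inner_leviCivitaFun hv (hf.smul_section hY) hw] at h
    simpa [inner_add_left, inner_smul_left] using h

variable (E M) in
/-- The Levi-Civita connection of a Riemannian manifold. -/
def leviCivita : CovariantDerivative 𝓘(ℝ, E) E (fun x : M ↦ TangentSpace 𝓘(ℝ, E) x) where
  toFun := leviCivitaFun
  isCovariantDerivativeOnUniv := leviCivitaFun_isCovariantDerivativeOn

theorem leviCivita_torsion : (leviCivita E M).torsion = 0 := by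
  rw [CovariantDerivative.torsion_eq_zero_iff]
  intro X Y x hX hY
  refine ext_inner_right ℝ fun w ↦ ?_
  have hw := mdifferentiableAt_extend 𝓘(ℝ, E) E w
  have h1 := inner_leviCivitaFun hX hY hw
  have h2 := inner_leviCivitaFun hY hX hw
  simp only [extend_apply_self] at h1 h2
  rw [inner_sub_left]
  change inner ℝ (leviCivitaFun Y x (X x)) w - inner ℝ (leviCivitaFun X x (Y x)) w = _
  rw [h1, h2]
  simp only [koszul, real_inner_comm, mlieBracket_swap_apply (V := Y) (W := X),
    mlieBracket_swap_apply (V := extend E w), inner_neg_right, extend_apply_self]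
  ring

theorem leviCivita_metric (hX : MDiffAt (T% X) x) (hY : MDiffAt (T% Y) x)
    (hZ : MDiffAt (T% Z) x) :
    d% (fun y ↦ inner ℝ (Y y) (Z y)) x (X x) =
      inner ℝ (leviCivita E M Y x (X x)) (Z x) + inner ℝ (Y x) (leviCivita E M Z x (X x)) := by
  have h1 := inner_leviCivitaFun hX hY hZ
  have h2 := inner_leviCivitaFun hX hZ hY
  change _ = inner ℝ (leviCivitaFun Y x (X x)) (Z x) + inner ℝ (Y x) (leviCivitaFun Z x (X x))
  rw [real_inner_comm _ (Y x), h1, h2]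
  simp only [koszul]
  simp only [real_inner_comm, mlieBracket_swap_apply (V := Y) (W := X),
    mlieBracket_swap_apply (V := Z) (W := X), mlieBracket_swap_apply (V := Z) (W := Y), inner_neg_right]
  ring

end LeviCivita

section Curvature

/-! Tensors are evaluated on tangent vectors at `x` by means of `FiberBundle.extend E v`, a vector
field that is smooth near `x` and has the value `v` at `x`. -/

variable {E : Type*} [NormedAddCommGroup E] [NormedSpace ℝ E] [FiniteDimensional ℝ E]
  {M : Type*} [TopologicalSpace M] [ChartedSpace E M] [IsManifold 𝓘(ℝ, E) ∞ M]
  [RiemannianBundle (fun x : M ↦ TangentSpace 𝓘(ℝ, E) x)]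
  [IsContMDiffRiemannianBundle 𝓘(ℝ, E) ∞ E (fun x : M ↦ TangentSpace 𝓘(ℝ, E) x)]

/-- `R_{X,Y} Z = ∇_{[X,Y]} Z - (∇_X ∇_Y Z - ∇_Y ∇_X Z)` for vector fields. -/
def curvatureField (X Y Z : Π x : M, TangentSpace 𝓘(ℝ, E) x) (x : M) : TangentSpace 𝓘(ℝ, E) x :=
  leviCivita E M Z x (mlieBracket 𝓘(ℝ, E) X Y x)
    - (leviCivita E M (fun y ↦ leviCivita E M Z y (Y y)) x (X x)
      - leviCivita E M (fun y ↦ leviCivita E M Z y (X y)) x (Y x))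

/-- The curvature tensor `R_{u,v} w` on tangent vectors. -/
def curvature (x : M) (u v w : TangentSpace 𝓘(ℝ, E) x) : TangentSpace 𝓘(ℝ, E) x :=
  curvatureField (extend E u) (extend E v) (extend E w) x

/-- `Ric(v, w) = ∑ i, ⟨R_{v,e_i} w, e_i⟩` for an orthonormal basis `e_i`. -/
def ricci (x : M) (v w : TangentSpace 𝓘(ℝ, E) x) : ℝ :=
  ∑ i, inner ℝ (curvature x v (stdOrthonormalBasis ℝ (TangentSpace 𝓘(ℝ, E) x) i) w)
    (stdOrthonormalBasis ℝ (TangentSpace 𝓘(ℝ, E) x) i)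

variable (E M) in
/-- The metric is Einstein: `Ric` is a constant multiple of the metric. -/
def IsEinstein : Prop :=
  ∃ c : ℝ, ∀ (x : M) (v w : TangentSpace 𝓘(ℝ, E) x), ricci x v w = c * inner ℝ v w

variable (E M) in
/-- The metric is Ricci-flat. -/
def IsRicciFlat : Prop :=
  ∀ (x : M) (v w : TangentSpace 𝓘(ℝ, E) x), ricci x v w = 0

/-- The exterior derivative of a one-form,
`dθ(X, Y) = X (θ Y) - Y (θ X) - θ [X, Y]`, on tangent vectors. -/
def oneFormDeriv (θ : Π x : M, TangentSpace 𝓘(ℝ, E) x → ℝ) (x : M)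
    (v w : TangentSpace 𝓘(ℝ, E) x) : ℝ :=
  d% (fun y ↦ θ y (extend E w y)) x v - d% (fun y ↦ θ y (extend E v y)) x w
    - θ x (mlieBracket 𝓘(ℝ, E) (extend E v) (extend E w) x)

/-- The inner product `⟨A, B⟩ = ∑ i, ⟨A e_i, B e_i⟩` on endomorphisms of a tangent space. -/
def endInner {x : M} (A B : TangentSpace 𝓘(ℝ, E) x →L[ℝ] TangentSpace 𝓘(ℝ, E) x) : ℝ :=
  ∑ i, inner ℝ (A (stdOrthonormalBasis ℝ (TangentSpace 𝓘(ℝ, E) x) i))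
    (B (stdOrthonormalBasis ℝ (TangentSpace 𝓘(ℝ, E) x) i))

/-- Membership in `so(T_x M)`. -/
def IsSkew {x : M} (A : TangentSpace 𝓘(ℝ, E) x →L[ℝ] TangentSpace 𝓘(ℝ, E) x) : Prop :=
  ∀ v w, inner ℝ (A v) w = -inner ℝ v (A w)

end Curvature

section Structures

variable (E : Type*) [NormedAddCommGroup E] [NormedSpace ℝ E] [FiniteDimensional ℝ E]
  (M : Type*) [TopologicalSpace M] [ChartedSpace E M] [IsManifold 𝓘(ℝ, E) ∞ M]
  [RiemannianBundle (fun x : M ↦ TangentSpace 𝓘(ℝ, E) x)]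

/-- A smooth orthogonal almost complex structure on a Riemannian manifold. -/
structure AlmostHermitianStructure where
  /-- The almost complex structure. -/
  J : Π x : M, TangentSpace 𝓘(ℝ, E) x →L[ℝ] TangentSpace 𝓘(ℝ, E) x
  contMDiff_J : ContMDiff 𝓘(ℝ, E) (𝓘(ℝ, E).prod 𝓘(ℝ, E →L[ℝ] E)) ∞
    (fun x ↦ TotalSpace.mk' (E →L[ℝ] E)
      (E := fun x : M ↦ TangentSpace 𝓘(ℝ, E) x →L[ℝ] TangentSpace 𝓘(ℝ, E) x) x (J x))
  J_J : ∀ x v, J x (J x v) = -v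
  inner_J_J : ∀ x v w, inner ℝ (J x v) (J x w) = inner ℝ v w

namespace AlmostHermitianStructure

variable {E M} (S : AlmostHermitianStructure E M)

/-- The Kähler form `ω(v, w) = ⟨v, J w⟩`. -/
def kahlerForm (x : M) (v w : TangentSpace 𝓘(ℝ, E) x) : ℝ := inner ℝ v (S.J x w)

/-- The Hermitian scalar product `⟨v, w⟩ + i ω(v, w)`, complex linear in `v`. -/
def hermitian (x : M) (v w : TangentSpace 𝓘(ℝ, E) x) : ℂ := ⟨inner ℝ v w, S.kahlerForm x v w⟩

/-- `u` is orthonormal for the Hermitian scalar product; in real dimension `2 n` it is then a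
unitary basis of the complex vector space `(T_x M, J)`. -/
def IsUnitaryFrame {n : ℕ} (x : M) (u : Fin n → TangentSpace 𝓘(ℝ, E) x) : Prop :=
  ∀ i j, S.hermitian x (u i) (u j) = if i = j then 1 else 0

end AlmostHermitianStructure

variable {E M} in
/-- The scalar product `(1 / n!) ∑ a(u_{i_1}, …, u_{i_n}) conj (b(u_{i_1}, …, u_{i_n}))` of two
complex `n`-forms, computed in the frame `u`. -/
def formHermitian {n : ℕ} {x : M} (a b : TangentSpace 𝓘(ℝ, E) x [⋀^Fin n]→ₗ[ℝ] ℂ)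
    (u : Fin n → TangentSpace 𝓘(ℝ, E) x) : ℂ :=
  (1 / (n.factorial : ℂ)) * ∑ k : Fin n → Fin n,
    a (fun i ↦ u (k i)) * starRingEnd ℂ (b (fun i ↦ u (k i)))

/-- An `SU(n)`-structure: an almost Hermitian structure together with a smooth complex volume form
`Ψ` of unit length. -/
structure SpecialAlmostHermitianStructure (n : ℕ) extends AlmostHermitianStructure E M where
  /-- The complex volume form `Ψ = ψ₊ + i ψ₋`. -/
  Ψ : Π x : M, TangentSpace 𝓘(ℝ, E) x [⋀^Fin n]→ₗ[ℝ] ℂ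
  /-- `Ψ` is smooth: its value on smooth vector fields is a smooth function. -/
  contMDiffAt_Ψ : ∀ (x : M) (X : Fin n → Π y : M, TangentSpace 𝓘(ℝ, E) y),
    (∀ i, CMDiffAt ∞ (T% (X i)) x) →
      ContMDiffAt 𝓘(ℝ, E) 𝓘(ℝ, ℂ) ∞ (fun y ↦ Ψ y (fun i ↦ X i y)) x
  /-- `Ψ` is complex multilinear on `(T_x M, J)`. -/
  Ψ_J : ∀ x v i, Ψ x (Function.update v i (J x (v i))) = Complex.I * Ψ x v
  /-- `⟨Ψ, Ψ⟩ = 1`. -/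
  Ψ_norm : ∀ x u, toAlmostHermitianStructure.IsUnitaryFrame x u → formHermitian (Ψ x) (Ψ x) u = 1

end Structures

section IntrinsicTorsion

variable {E : Type*} [NormedAddCommGroup E] [NormedSpace ℝ E] [FiniteDimensional ℝ E]
  {M : Type*} [TopologicalSpace M] [ChartedSpace E M] [IsManifold 𝓘(ℝ, E) ∞ M]
  [RiemannianBundle (fun x : M ↦ TangentSpace 𝓘(ℝ, E) x)]
  [IsContMDiffRiemannianBundle 𝓘(ℝ, E) ∞ E (fun x : M ↦ TangentSpace 𝓘(ℝ, E) x)]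

namespace AlmostHermitianStructure

variable (S : AlmostHermitianStructure E M)

/-- `Ric*(v, w) = ∑ i, ⟨R_{v,e_i} J w, J e_i⟩` for an orthonormal basis `e_i`. -/
def starRicci (x : M) (v w : TangentSpace 𝓘(ℝ, E) x) : ℝ :=
  ∑ i, inner ℝ (curvature x v (stdOrthonormalBasis ℝ (TangentSpace 𝓘(ℝ, E) x) i) (S.J x w))
    (S.J x (stdOrthonormalBasis ℝ (TangentSpace 𝓘(ℝ, E) x) i))

/-- `(∇_v J) w = ∇_v (J W) - J (∇_v W)` for a local extension `W` of `w`. -/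
def nablaJ (x : M) (v w : TangentSpace 𝓘(ℝ, E) x) : TangentSpace 𝓘(ℝ, E) x :=
  leviCivita E M (fun y ↦ S.J y (extend E w y)) x v - S.J x (leviCivita E M (extend E w) x v)

/-- The almost Hermitian structure is Kähler: `∇ J = 0` for the Levi-Civita connection. -/
def IsKahler : Prop := ∀ (x : M) (v w : TangentSpace 𝓘(ℝ, E) x), S.nablaJ x v w = 0

end AlmostHermitianStructure

/-- The action of an endomorphism on forms,
`(A · a)(w_1, …, w_n) = -∑ i, a(w_1, …, A w_i, …, w_n)`. -/
def endAction {n : ℕ} {x : M} (A : TangentSpace 𝓘(ℝ, E) x →L[ℝ] TangentSpace 𝓘(ℝ, E) x)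
    (a : TangentSpace 𝓘(ℝ, E) x [⋀^Fin n]→ₗ[ℝ] ℂ) (w : Fin n → TangentSpace 𝓘(ℝ, E) x) : ℂ :=
  -∑ i, a (Function.update w i (A (w i)))

namespace SpecialAlmostHermitianStructure

variable {n : ℕ} (S : SpecialAlmostHermitianStructure E M n)

/-- `(∇_v Ψ)(w_1, …, w_n) = v (Ψ(W_1, …, W_n)) - ∑ i, Ψ(w_1, …, ∇_v W_i, …, w_n)` for local
extensions `W_i` of `w_i`. -/
def nablaΨ (x : M) (v : TangentSpace 𝓘(ℝ, E) x) (w : Fin n → TangentSpace 𝓘(ℝ, E) x) : ℂ :=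
  mvfderiv 𝓘(ℝ, E) (fun y ↦ S.Ψ y (fun i ↦ extend E (w i) y)) x v
    - ∑ i, S.Ψ x (Function.update w i (leviCivita E M (extend E (w i)) x v))

/-- Membership in `su(n)` at `x`, the Lie algebra of the stabiliser of the metric, `J` and `Ψ`. -/
def IsSU (x : M) (B : TangentSpace 𝓘(ℝ, E) x →L[ℝ] TangentSpace 𝓘(ℝ, E) x) : Prop :=
  IsSkew B ∧ (∀ w, B (S.J x w) = S.J x (B w)) ∧ ∀ w, endAction B (S.Ψ x) w = 0

/-- Membership in the orthogonal complement of `su(n)` in `so(T_x M)`. -/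
def IsSUPerp (x : M) (A : TangentSpace 𝓘(ℝ, E) x →L[ℝ] TangentSpace 𝓘(ℝ, E) x) : Prop :=
  IsSkew A ∧ ∀ B, S.IsSU x B → endInner A B = 0

/-- `A` is the value in the direction `v` of the intrinsic `SU(n)`-torsion, i.e. `A` lies in
`su(n)^⊥` and `∇_v + A` annihilates `J` and `Ψ` (and the metric, as `A` is skew). -/
def IsIntrinsicTorsionAt (x : M) (v : TangentSpace 𝓘(ℝ, E) x)
    (A : TangentSpace 𝓘(ℝ, E) x →L[ℝ] TangentSpace 𝓘(ℝ, E) x) : Prop :=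
  S.IsSUPerp x A ∧
  (∀ w, S.nablaJ x v w + (A (S.J x w) - S.J x (A w)) = 0) ∧
  ∀ w, S.nablaΨ x v w + endAction A (S.Ψ x) w = 0

/-- The intrinsic `SU(n)`-torsion `η + ξ`: the difference between the minimal `SU(n)`-connection
and the Levi-Civita connection. At each point and in each direction it is the unique endomorphism
satisfying `IsIntrinsicTorsionAt`. -/
def intrinsicTorsion (x : M) (v : TangentSpace 𝓘(ℝ, E) x) :
    TangentSpace 𝓘(ℝ, E) x →L[ℝ] TangentSpace 𝓘(ℝ, E) x :=
  Classical.epsilon (S.IsIntrinsicTorsionAt x v)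

/-- The one-form `η̂` with `η_v w = η̂(v) J w`, where `η` is the component of the intrinsic torsion
in `T* M ⊗ ℝ ω`, i.e. its orthogonal projection to the line spanned by `J`. -/
def etaHat (x : M) (v : TangentSpace 𝓘(ℝ, E) x) : ℝ :=
  endInner (S.intrinsicTorsion x v) (S.J x) / endInner (S.J x) (S.J x)

end SpecialAlmostHermitianStructure

end IntrinsicTorsion

end

/-! On a Kähler manifold the curvature commutes with the isometry `J`, which gives `Ric* = Ric` at
once. The rest follows from the identity `Ric(v, w) = n dη̂(v, J w)`
(`ricci_eq_oneFormDeriv_etaHat`), because `ω(v, J w) = -⟨v, w⟩`.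

Since `J` is parallel, `∇_v Ψ` is again complex multilinear of top degree, hence a multiple of `Ψ`,
and the multiple is imaginary because `Ψ` has constant length. As `J` acts on `Ψ` by `-i n`, the
torsion in the direction `v` is `η̂(v) J`, and `∇_v Ψ = i n η̂(v) Ψ` (`nablaΨ_eq_etaHat_smul`).

For a local unitary frame `U` put `f = Ψ(U)` and let `α` be the trace of its connection form
(`traceForm`). Then `df = i (n η̂ + α) f` with `f ≠ 0`, so `n η̂ + α` is closed. Since `dα` is minus
the complex trace of the curvature (`traceForm_deriv`), `n dη̂` equals that trace
(`sum_inner_curvature_J`). The first Bianchi identity identifies the real trace of `R_{v,Jw}`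
against `J`, twice the complex one, with `2 Ric(v, w)` (`sum_inner_curvature_J_eq`). -/

set_option linter.unusedSectionVars false

/-! ### Smooth functions, vector fields and Lie brackets -/

section Calculus

variable {E : Type*} [NormedAddCommGroup E] [NormedSpace ℝ E]
  {M : Type*} [TopologicalSpace M] [ChartedSpace E M] [IsManifold 𝓘(ℝ, E) ∞ M]
  {F : Type*} [NormedAddCommGroup F] [NormedSpace ℝ F]
  {X Y Z : Π x : M, TangentSpace 𝓘(ℝ, E) x} {x : M}

theorem ContMDiffAt.mdiffAt_section (hX : CMDiffAt ∞ (T% X) x) : MDiffAt (T% X) x :=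
  hX.mdifferentiableAt (by simp)

theorem ContMDiffAt.eventually_mdiffAt_section (hX : CMDiffAt ∞ (T% X) x) :
    ∀ᶠ y in 𝓝 x, MDiffAt (T% X) y := by
  -- Order `∞` at a point allows the neighbourhood to shrink with the order, so only a finite order
  -- spreads to nearby points.
  have h1 : CMDiffAt 1 (T% X) x := hX.of_le (by simp)
  exact ((contMDiffAt_iff_contMDiffAt_nhds (by simp)).1 h1).mono
    fun y hy ↦ hy.mdifferentiableAt one_ne_zero

theorem ContMDiffAt.mdiffAt {f : M → F} (hf : CMDiffAt ∞ f x) : MDiffAt f x :=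
  hf.mdifferentiableAt (by simp)

theorem ContMDiffAt.eventually_mdiffAt {f : M → F} (hf : CMDiffAt ∞ f x) :
    ∀ᶠ y in 𝓝 x, MDiffAt f y := by
  have h1 : CMDiffAt 1 f x := hf.of_le (by simp)
  exact ((contMDiffAt_iff_contMDiffAt_nhds (by simp)).1 h1).mono
    fun y hy ↦ hy.mdifferentiableAt one_ne_zero

/-- The derivative of a smooth function along a smooth vector field is smooth. -/
theorem ContMDiffAt.mvfderiv_apply {f : M → F} (hf : CMDiffAt ∞ f x) (hX : CMDiffAt ∞ (T% X) x) :
    CMDiffAt ∞ (fun y ↦ d% f y (X y)) x := by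
  have h : CMDiffAt ∞ (fun y ↦ (⟨f y, mfderiv% f y (X y)⟩ : TangentBundle 𝓘(ℝ, F) F)) x :=
    ContMDiffAt.clm_apply_of_inCoordinates (b₁ := id) (b₂ := f)
      (E₁ := fun x : M ↦ TangentSpace 𝓘(ℝ, E) x) (E₂ := fun x : F ↦ TangentSpace 𝓘(ℝ, F) x)
      (hf.mfderiv_const (m := ∞) (by simp)) hX hf
  exact (contMDiff_snd_tangentBundle_modelSpace F 𝓘(ℝ, F)).contMDiffAt.comp x h

theorem Filter.EventuallyEq.mvfderiv_eq {f g : M → F} (h : f =ᶠ[𝓝 x] g) : d% f x = d% g x := by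
  simp only [mvfderiv, h.mfderiv_eq]
  rw [h.eq_of_nhds]

variable [CompleteSpace E]

theorem ContMDiffAt.mlieBracket (hX : CMDiffAt ∞ (T% X) x) (hY : CMDiffAt ∞ (T% Y) x) :
    CMDiffAt ∞ (T% (mlieBracket 𝓘(ℝ, E) X Y)) x :=
  haveI : IsManifold 𝓘(ℝ, E) (((⊤ : ℕ∞) : ℕ∞ω) + 1) M := inferInstanceAs (IsManifold 𝓘(ℝ, E) ∞ M)
  haveI : IsManifold 𝓘(ℝ, E) (minSmoothness ℝ 2) M := by
    rw [minSmoothness_of_isRCLikeNormedField]; infer_instance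
  ContMDiffAt.mlieBracket_vectorField (m := ⊤) (n := ⊤) hX hY
    (by rw [minSmoothness_of_isRCLikeNormedField]; rfl)

theorem jacobi_mlieBracket (hX : CMDiffAt ∞ (T% X) x) (hY : CMDiffAt ∞ (T% Y) x)
    (hZ : CMDiffAt ∞ (T% Z) x) :
    mlieBracket 𝓘(ℝ, E) X (mlieBracket 𝓘(ℝ, E) Y Z) x =
      mlieBracket 𝓘(ℝ, E) (mlieBracket 𝓘(ℝ, E) X Y) Z x +
        mlieBracket 𝓘(ℝ, E) Y (mlieBracket 𝓘(ℝ, E) X Z) x := by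
  have : IsManifold 𝓘(ℝ, E) (minSmoothness ℝ 3) M := by
    rw [minSmoothness_of_isRCLikeNormedField]; infer_instance
  have h2 : minSmoothness ℝ 2 ≤ (∞ : ℕ∞ω) := by
    rw [minSmoothness_of_isRCLikeNormedField]; exact ENat.LEInfty.out
  exact leibniz_identity_mlieBracket_apply (hX.of_le h2) (hY.of_le h2) (hZ.of_le h2)

/-- The Lie bracket acts on functions as the commutator of the derivations. -/
theorem mvfderiv_mlieBracket [Nontrivial E] {f : M → ℝ} (hf : CMDiffAt ∞ f x)
    (hX : CMDiffAt ∞ (T% X) x) (hY : CMDiffAt ∞ (T% Y) x) :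
    d% f x (mlieBracket 𝓘(ℝ, E) X Y x) =
      d% (fun y ↦ d% f y (Y y)) x (X x) - d% (fun y ↦ d% f y (X y)) x (Y x) := by
  -- The identity is read off from the Jacobi identity for `X`, `Y`, `f Z` with `Z x = z ≠ 0`: after
  -- subtracting `f` times the Jacobi identity for `X`, `Y`, `Z`, only a multiple of `z` survives.
  obtain ⟨z, hz⟩ : ∃ z : TangentSpace 𝓘(ℝ, E) x, z ≠ 0 := exists_ne (0 : E)
  set Z := extend E z with hZdef
  have hZx : Z x = z := by simp [hZdef]
  have hZ : CMDiffAt ∞ (T% Z) x := contMDiffAt_extend 𝓘(ℝ, E) E z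
  have bracket_smul {A : Π x : M, TangentSpace 𝓘(ℝ, E) x} (hA : CMDiffAt ∞ (T% A) x) :
      mlieBracket 𝓘(ℝ, E) A (f • Z) =ᶠ[𝓝 x]
        (fun y ↦ d% f y (A y)) • Z + f • mlieBracket 𝓘(ℝ, E) A Z := by
    filter_upwards [hf.eventually_mdiffAt, hZ.eventually_mdiffAt_section] with y hfy hZy
    exact mlieBracket_smul_right hfy hZy
  have expand {A B : Π x : M, TangentSpace 𝓘(ℝ, E) x} (hA : CMDiffAt ∞ (T% A) x)
      (hB : CMDiffAt ∞ (T% B) x) :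
      mlieBracket 𝓘(ℝ, E) A (mlieBracket 𝓘(ℝ, E) B (f • Z)) x =
        (d% (fun y ↦ d% f y (B y)) x (A x) • z + d% f x (B x) • mlieBracket 𝓘(ℝ, E) A Z x) +
          (d% f x (A x) • mlieBracket 𝓘(ℝ, E) B Z x +
            f x • mlieBracket 𝓘(ℝ, E) A (mlieBracket 𝓘(ℝ, E) B Z) x) := by
    have hfB := hf.mvfderiv_apply hB
    have hBZ := hB.mlieBracket hZ
    rw [Filter.EventuallyEq.rfl.mlieBracket_vectorField_eq (bracket_smul hB),
      mlieBracket_add_right (hfB.smul_section hZ).mdiffAt_section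
        (hf.smul_section hBZ).mdiffAt_section,
      mlieBracket_smul_right hfB.mdiffAt hZ.mdiffAt_section,
      mlieBracket_smul_right hf.mdiffAt hBZ.mdiffAt_section, hZx]
  have key := jacobi_mlieBracket hX hY (hf.smul_section hZ)
  rw [expand hX hY, expand hY hX, mlieBracket_smul_right hf.mdiffAt hZ.mdiffAt_section,
    jacobi_mlieBracket hX hY hZ, hZx] at key
  have h0 : (d% f x (mlieBracket 𝓘(ℝ, E) X Y x) -
      (d% (fun y ↦ d% f y (Y y)) x (X x) - d% (fun y ↦ d% f y (X y)) x (Y x))) • z = 0 := by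
    simp only [smul_add, sub_smul] at key ⊢
    rw [← sub_eq_zero] at key
    rw [← neg_eq_zero, ← key]
    abel
  exact sub_eq_zero.1 ((smul_eq_zero.1 h0).resolve_right hz)

end Calculus

/-! ### Unitary frames and smoothness tests -/

section UnitaryFrames

variable {E : Type*} [NormedAddCommGroup E] [NormedSpace ℝ E] [FiniteDimensional ℝ E]
  {M : Type*} [TopologicalSpace M] [ChartedSpace E M] [IsManifold 𝓘(ℝ, E) ∞ M]
  [RiemannianBundle (fun x : M ↦ TangentSpace 𝓘(ℝ, E) x)]

theorem finrank_tangentSpace (x : M) : finrank ℝ (TangentSpace 𝓘(ℝ, E) x) = finrank ℝ E := rfl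

namespace AlmostHermitianStructure

variable (S : AlmostHermitianStructure E M) {x : M}

theorem inner_J_left (v w : TangentSpace 𝓘(ℝ, E) x) :
    inner ℝ (S.J x v) w = -inner ℝ v (S.J x w) := by
  rw [← S.inner_J_J x v (S.J x w), S.J_J, inner_neg_right, neg_neg]

theorem inner_self_J (v : TangentSpace 𝓘(ℝ, E) x) : inner ℝ v (S.J x v) = 0 := by
  have h := S.inner_J_left v v
  rw [real_inner_comm] at h
  linarith

variable {S} {n : ℕ}

theorem IsUnitaryFrame.inner_eq {u : Fin n → TangentSpace 𝓘(ℝ, E) x} (hu : S.IsUnitaryFrame x u)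
    (i j : Fin n) : inner ℝ (u i) (u j) = if i = j then (1 : ℝ) else 0 := by
  have h := congrArg Complex.re (hu i j)
  rw [hermitian] at h
  split_ifs at h ⊢ <;> simpa using h

theorem IsUnitaryFrame.inner_J_eq {u : Fin n → TangentSpace 𝓘(ℝ, E) x}
    (hu : S.IsUnitaryFrame x u) (i j : Fin n) : inner ℝ (u i) (S.J x (u j)) = (0 : ℝ) := by
  have h := congrArg Complex.im (hu i j)
  rw [hermitian, kahlerForm] at h
  split_ifs at h <;> simpa using h

theorem isUnitaryFrame_of_inner {u : Fin n → TangentSpace 𝓘(ℝ, E) x}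
    (h : ∀ i j, inner ℝ (u i) (u j) = if i = j then (1 : ℝ) else 0)
    (hJ : ∀ i j, inner ℝ (u i) (S.J x (u j)) = (0 : ℝ)) : S.IsUnitaryFrame x u := by
  intro i j
  apply Complex.ext
  · simp only [hermitian, h]; split_ifs <;> simp
  · simp only [hermitian, kahlerForm, hJ]; split_ifs <;> simp

theorem IsUnitaryFrame.orthonormal {u : Fin n → TangentSpace 𝓘(ℝ, E) x}
    (hu : S.IsUnitaryFrame x u) :
    Orthonormal ℝ (Sum.elim u fun i ↦ S.J x (u i)) := by
  rw [orthonormal_iff_ite]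
  rintro (i | i) (j | j)
  · simp [hu.inner_eq]
  · simp [hu.inner_J_eq]
  · simp [S.inner_J_left, hu.inner_J_eq]
  · simp [S.inner_J_J, hu.inner_eq]

/-- The real orthonormal basis `u_1, …, u_n, J u_1, …, J u_n` attached to a unitary frame. -/
noncomputable def IsUnitaryFrame.orthonormalBasis {u : Fin n → TangentSpace 𝓘(ℝ, E) x}
    (hu : S.IsUnitaryFrame x u) (hE : finrank ℝ E = 2 * n) :
    OrthonormalBasis (Fin n ⊕ Fin n) ℝ (TangentSpace 𝓘(ℝ, E) x) :=
  OrthonormalBasis.mk hu.orthonormal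
    (hu.orthonormal.linearIndependent.span_eq_top_of_card_eq_finrank'
      (by rw [finrank_tangentSpace, hE]; simp [two_mul])).ge

theorem IsUnitaryFrame.orthonormalBasis_inl {u : Fin n → TangentSpace 𝓘(ℝ, E) x}
    (hu : S.IsUnitaryFrame x u) (hE : finrank ℝ E = 2 * n) (i : Fin n) :
    hu.orthonormalBasis hE (Sum.inl i) = u i := by
  simp [orthonormalBasis]

theorem IsUnitaryFrame.orthonormalBasis_inr {u : Fin n → TangentSpace 𝓘(ℝ, E) x}
    (hu : S.IsUnitaryFrame x u) (hE : finrank ℝ E = 2 * n) (i : Fin n) :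
    hu.orthonormalBasis hE (Sum.inr i) = S.J x (u i) := by
  simp [orthonormalBasis]

theorem IsUnitaryFrame.sum_repr {u : Fin n → TangentSpace 𝓘(ℝ, E) x}
    (hu : S.IsUnitaryFrame x u) (hE : finrank ℝ E = 2 * n) (v : TangentSpace 𝓘(ℝ, E) x) :
    v = ∑ i, ((inner ℝ v (u i) : ℝ) • u i + (inner ℝ v (S.J x (u i)) : ℝ) • S.J x (u i)) := by
  conv_lhs => rw [← (hu.orthonormalBasis hE).sum_repr' v]
  simp only [Fintype.sum_sum_type, hu.orthonormalBasis_inl, hu.orthonormalBasis_inr,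
    real_inner_comm v, Finset.sum_add_distrib]

/-- The trace of a bilinear form computed in a unitary frame. -/
theorem IsUnitaryFrame.sum_inner_apply {u : Fin n → TangentSpace 𝓘(ℝ, E) x}
    (hu : S.IsUnitaryFrame x u) (hE : finrank ℝ E = 2 * n)
    (A : TangentSpace 𝓘(ℝ, E) x →ₗ[ℝ] TangentSpace 𝓘(ℝ, E) x) {ι : Type*} [Fintype ι]
    (e : OrthonormalBasis ι ℝ (TangentSpace 𝓘(ℝ, E) x)) :
    ∑ i, inner ℝ (e i) (A (e i)) =
      ∑ i, (inner ℝ (u i) (A (u i)) + inner ℝ (S.J x (u i)) (A (S.J x (u i))) : ℝ) := by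
  rw [← A.trace_eq_sum_inner e, A.trace_eq_sum_inner (hu.orthonormalBasis hE)]
  simp [Fintype.sum_sum_type, hu.orthonormalBasis_inl, hu.orthonormalBasis_inr,
    Finset.sum_add_distrib]

/-- Supplies the next Gram–Schmidt vector: the `2k` vectors `u_i`, `J u_i` cannot span a space of
larger dimension. -/
theorem exists_ne_zero_orthogonal {k : ℕ} (hk : 2 * k < finrank ℝ E)
    (u : Fin k → TangentSpace 𝓘(ℝ, E) x) :
    ∃ w : TangentSpace 𝓘(ℝ, E) x, w ≠ 0 ∧ (∀ i, inner ℝ w (u i) = (0 : ℝ)) ∧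
      ∀ i, inner ℝ w (S.J x (u i)) = (0 : ℝ) := by
  set f : Fin k ⊕ Fin k → TangentSpace 𝓘(ℝ, E) x := Sum.elim u fun i ↦ S.J x (u i)
  have hne : (Submodule.span ℝ (Set.range f))ᗮ ≠ ⊥ := by
    intro h
    rw [Submodule.orthogonal_eq_bot_iff] at h
    have h1 := finrank_range_le_card (R := ℝ) f
    rw [Set.finrank, h, finrank_top, finrank_tangentSpace] at h1
    simp at h1
    omega
  obtain ⟨w, hw, hw0⟩ := Submodule.exists_mem_ne_zero_of_ne_bot hne
  rw [Submodule.mem_orthogonal'] at hw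
  exact ⟨w, hw0, fun i ↦ hw _ (Submodule.subset_span ⟨Sum.inl i, rfl⟩),
    fun i ↦ hw _ (Submodule.subset_span ⟨Sum.inr i, rfl⟩)⟩

theorem contMDiffAt_J {X : Π x : M, TangentSpace 𝓘(ℝ, E) x} (hX : CMDiffAt ∞ (T% X) x) :
    CMDiffAt ∞ (T% (fun y ↦ S.J y (X y))) x :=
  ContMDiffAt.clm_bundle_apply (b := fun y : M ↦ y) (E₁ := fun x : M ↦ TangentSpace 𝓘(ℝ, E) x)
    (E₂ := fun x : M ↦ TangentSpace 𝓘(ℝ, E) x) S.contMDiff_J.contMDiffAt hX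

theorem mdiffAt_J {X : Π x : M, TangentSpace 𝓘(ℝ, E) x} (hX : MDiffAt (T% X) x) :
    MDiffAt (T% (fun y ↦ S.J y (X y))) x :=
  MDifferentiableAt.clm_bundle_apply (b := fun y : M ↦ y)
    (E₁ := fun x : M ↦ TangentSpace 𝓘(ℝ, E) x)
    (E₂ := fun x : M ↦ TangentSpace 𝓘(ℝ, E) x)
    (S.contMDiff_J.contMDiffAt.mdifferentiableAt (by simp)) hX

variable [IsContMDiffRiemannianBundle 𝓘(ℝ, E) ∞ E (fun x : M ↦ TangentSpace 𝓘(ℝ, E) x)]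

theorem _root_.contMDiffAt_inner {X Y : Π x : M, TangentSpace 𝓘(ℝ, E) x}
    (hX : CMDiffAt ∞ (T% X) x) (hY : CMDiffAt ∞ (T% Y) x) :
    CMDiffAt ∞ (fun y ↦ (inner ℝ (X y) (Y y) : ℝ)) x :=
  ContMDiffAt.inner_bundle (E := fun x : M ↦ TangentSpace 𝓘(ℝ, E) x) (b := fun y ↦ y) hX hY

variable (S) (x) in
/-- Gram–Schmidt: smooth unitary families exist near every point. -/
theorem exists_smooth_unitary (k : ℕ) (hk : 2 * k ≤ finrank ℝ E) :
    ∃ U : Fin k → Π y : M, TangentSpace 𝓘(ℝ, E) y, (∀ i, CMDiffAt ∞ (T% (U i)) x) ∧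
      ∀ᶠ y in 𝓝 x, S.IsUnitaryFrame y (fun i ↦ U i y) := by
  induction k with
  | zero => exact ⟨fun i ↦ i.elim0, fun i ↦ i.elim0, .of_forall fun y i ↦ i.elim0⟩
  | succ k ih =>
    obtain ⟨U, hU, hUu⟩ := ih (by omega)
    obtain ⟨w, hw0, hw, hwJ⟩ := S.exists_ne_zero_orthogonal (by omega) (fun i ↦ U i x)
    have hW : CMDiffAt ∞ (T% (extend E w)) x := contMDiffAt_extend 𝓘(ℝ, E) E w
    set W := extend E w with hWdef
    have hWx : W x = w := by simp [hWdef]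
    -- The projection of `W` to the complex span of the `U_i`. It vanishes at `x` by the choice of
    -- `w`, so `W - P` is nonzero at `x` and hence nearby, where it can be normalised.
    set P : Π y : M, TangentSpace 𝓘(ℝ, E) y := fun y ↦
      ∑ i, ((inner ℝ (W y) (U i y) : ℝ) • U i y +
        (inner ℝ (W y) (S.J y (U i y)) : ℝ) • S.J y (U i y)) with hPdef
    have hP : CMDiffAt ∞ (T% P) x := by
      refine ContMDiffAt.sum_section fun i _ ↦ ?_
      exact ((contMDiffAt_inner hW (hU i)).smul_section (hU i)).add_section
        ((contMDiffAt_inner hW (contMDiffAt_J (hU i))).smul_section (contMDiffAt_J (hU i)))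
    set V : Π y : M, TangentSpace 𝓘(ℝ, E) y := W - P with hVdef
    have hV : CMDiffAt ∞ (T% V) x := hW.sub_section hP
    have hVx : V x = w := by simp [hVdef, hPdef, hWx, hw, hwJ]
    have hVV : CMDiffAt ∞ (fun y ↦ (inner ℝ (V y) (V y) : ℝ)) x := contMDiffAt_inner hV hV
    have hpos : (0 : ℝ) < inner ℝ (V x) (V x) := by rw [hVx]; exact real_inner_self_pos.2 hw0
    set N : M → ℝ := fun y ↦ (Real.sqrt (inner ℝ (V y) (V y)))⁻¹ with hNdef
    have hN : CMDiffAt ∞ N x := by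
      have h1 : ContDiffAt ℝ ∞ (fun t : ℝ ↦ (Real.sqrt t)⁻¹) (inner ℝ (V x) (V x)) :=
        ((contDiffAt_id.sqrt hpos.ne').inv (by simpa using (Real.sqrt_pos.2 hpos).ne'))
      exact ContMDiffAt.comp (f := fun y ↦ (inner ℝ (V y) (V y) : ℝ)) x h1.contMDiffAt hVV
    refine ⟨Fin.snoc U (N • V), fun i ↦ ?_, ?_⟩
    · refine Fin.lastCases ?_ (fun j ↦ ?_) i
      · simpa using hN.smul_section hV
      · simpa using hU j
    · filter_upwards [hUu, hVV.continuousAt.eventually (lt_mem_nhds hpos)] with y hy hposy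
      have hVU : ∀ i, inner ℝ (V y) (U i y) = (0 : ℝ) := fun i ↦ by
        simp [hVdef, hPdef, inner_sub_left, sum_inner, inner_add_left, inner_smul_left,
          hy.inner_eq, S.inner_J_left, hy.inner_J_eq]
      have hVJU : ∀ i, inner ℝ (V y) (S.J y (U i y)) = (0 : ℝ) := fun i ↦ by
        simp [hVdef, hPdef, inner_sub_left, sum_inner, inner_add_left, inner_smul_left,
          hy.inner_eq, S.inner_J_J, hy.inner_J_eq]
      have hN2 : N y * (N y * inner ℝ (V y) (V y)) = 1 := by
        have h2 := Real.mul_self_sqrt hposy.le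
        have h3 := (Real.sqrt_pos.2 hposy).ne'
        simp only [hNdef]
        field_simp
        rw [sq, h2]
      refine isUnitaryFrame_of_inner (fun i j ↦ ?_) (fun i j ↦ ?_)
      · refine Fin.lastCases ?_ (fun i ↦ ?_) i <;> refine Fin.lastCases ?_ (fun j ↦ ?_) j
        · simpa only [Fin.snoc_last, if_true, Pi.smul_apply', real_inner_smul_left,
            real_inner_smul_right] using hN2
        · simp [inner_smul_left, hVU, (Fin.castSucc_lt_last _).ne']
        · simp [inner_smul_right, real_inner_comm (V y), hVU, (Fin.castSucc_lt_last _).ne]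
        · simp [hy.inner_eq]
      · refine Fin.lastCases ?_ (fun i ↦ ?_) i <;> refine Fin.lastCases ?_ (fun j ↦ ?_) j
        · simp [inner_smul_left, inner_smul_right, S.inner_self_J]
        · simp [inner_smul_left, hVJU]
        · have h := S.inner_J_left (U i y) (V y)
          rw [real_inner_comm, hVJU] at h
          simp [inner_smul_right]
          right; linarith
        · simp [hy.inner_J_eq]

variable (S)

theorem exists_unitaryFrame (hE : finrank ℝ E = 2 * n) (x : M) :
    ∃ u : Fin n → TangentSpace 𝓘(ℝ, E) x, S.IsUnitaryFrame x u := by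
  obtain ⟨U, -, hU⟩ := S.exists_smooth_unitary x n hE.ge
  exact ⟨_, hU.self_of_nhds⟩

/-- A vector field is smooth as soon as its scalar products with smooth vector fields are. -/
theorem contMDiffAt_of_inner (S : AlmostHermitianStructure E M) (hE : finrank ℝ E = 2 * n)
    {V : Π x : M, TangentSpace 𝓘(ℝ, E) x}
    (h : ∀ W : Π x : M, TangentSpace 𝓘(ℝ, E) x, CMDiffAt ∞ (T% W) x →
      CMDiffAt ∞ (fun y ↦ (inner ℝ (V y) (W y) : ℝ)) x) : CMDiffAt ∞ (T% V) x := by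
  obtain ⟨U, hU, hUu⟩ := S.exists_smooth_unitary x n hE.ge
  have hsum : CMDiffAt ∞ (T% (fun y ↦ ∑ i, ((inner ℝ (V y) (U i y) : ℝ) • U i y +
      (inner ℝ (V y) (S.J y (U i y)) : ℝ) • S.J y (U i y)))) x := by
    refine ContMDiffAt.sum_section fun i _ ↦ ?_
    exact ((h _ (hU i)).smul_section (hU i)).add_section
      ((h _ (contMDiffAt_J (hU i))).smul_section (contMDiffAt_J (hU i)))
  refine hsum.congr_of_eventuallyEq ?_
  filter_upwards [hUu] with y hy
  simp only [TotalSpace.mk_inj]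
  exact hy.sum_repr hE (V y)

/-- The Koszul formula expresses the scalar products of `∇_X Y` with smooth fields through
derivatives and brackets of smooth data, and such scalar products detect smoothness. -/
theorem contMDiffAt_leviCivita (S : AlmostHermitianStructure E M) (hE : finrank ℝ E = 2 * n)
    {X Y : Π x : M, TangentSpace 𝓘(ℝ, E) x} (hX : CMDiffAt ∞ (T% X) x)
    (hY : CMDiffAt ∞ (T% Y) x) : CMDiffAt ∞ (T% (fun y ↦ leviCivita E M Y y (X y))) x := by
  refine S.contMDiffAt_of_inner hE fun Z hZ ↦ ?_
  have hk : CMDiffAt ∞ (koszul X Y Z) x :=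
    contMDiffAt_const.mul ((((((contMDiffAt_inner hY hZ).mvfderiv_apply hX).add
      ((contMDiffAt_inner hZ hX).mvfderiv_apply hY)).sub
      ((contMDiffAt_inner hX hY).mvfderiv_apply hZ)).add
      (contMDiffAt_inner (hX.mlieBracket hY) hZ)).sub
      (contMDiffAt_inner (hY.mlieBracket hZ) hX) |>.add
      (contMDiffAt_inner (hZ.mlieBracket hX) hY))
  refine hk.congr_of_eventuallyEq ?_
  filter_upwards [hX.eventually_mdiffAt_section, hY.eventually_mdiffAt_section,
    hZ.eventually_mdiffAt_section] with y hXy hYy hZy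
  exact inner_leviCivitaFun hXy hYy hZy

end AlmostHermitianStructure

end UnitaryFrames

/-! ### Symmetries of the curvature, in general and for Kähler metrics -/

section CurvatureIdentities

variable {E : Type*} [NormedAddCommGroup E] [NormedSpace ℝ E] [FiniteDimensional ℝ E]
  {M : Type*} [TopologicalSpace M] [ChartedSpace E M] [IsManifold 𝓘(ℝ, E) ∞ M]
  [RiemannianBundle (fun x : M ↦ TangentSpace 𝓘(ℝ, E) x)]
  [IsContMDiffRiemannianBundle 𝓘(ℝ, E) ∞ E (fun x : M ↦ TangentSpace 𝓘(ℝ, E) x)]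
  {X Y Z W : Π x : M, TangentSpace 𝓘(ℝ, E) x} {x : M}

theorem leviCivita_add (hX : MDiffAt (T% X) x) (hY : MDiffAt (T% Y) x)
    (v : TangentSpace 𝓘(ℝ, E) x) :
    leviCivita E M (X + Y) x v = leviCivita E M X x v + leviCivita E M Y x v := by
  rw [(leviCivita E M).isCovariantDerivativeOnUniv.add hX hY, add_apply]

theorem leviCivita_smul {f : M → ℝ} (hf : MDiffAt f x) (hX : MDiffAt (T% X) x)
    (v : TangentSpace 𝓘(ℝ, E) x) :
    leviCivita E M (f • X) x v = f x • leviCivita E M X x v + d% f x v • X x := by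
  rw [(leviCivita E M).isCovariantDerivativeOnUniv.leibniz hX hf]
  simp

theorem leviCivita_congr (hX : MDiffAt (T% X) x) (hY : MDiffAt (T% Y) x)
    (h : ∀ᶠ y in 𝓝 x, X y = Y y) : leviCivita E M X x = leviCivita E M Y x :=
  (leviCivita E M).isCovariantDerivativeOnUniv.congr_of_eventuallyEq hX hY Filter.univ_mem h

theorem leviCivita_sub_swap (hX : MDiffAt (T% X) x) (hY : MDiffAt (T% Y) x) :
    leviCivita E M Y x (X x) - leviCivita E M X x (Y x) = mlieBracket 𝓘(ℝ, E) X Y x :=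
  (CovariantDerivative.torsion_eq_zero_iff _).1 leviCivita_torsion hX hY

theorem leviCivita_inner (hY : MDiffAt (T% Y) x) (hZ : MDiffAt (T% Z) x)
    (v : TangentSpace 𝓘(ℝ, E) x) :
    d% (fun y ↦ inner ℝ (Y y) (Z y)) x v =
      inner ℝ (leviCivita E M Y x v) (Z x) + inner ℝ (Y x) (leviCivita E M Z x v) := by
  have h := leviCivita_metric (mdifferentiableAt_extend 𝓘(ℝ, E) E v) hY hZ
  simpa using h

theorem curvatureField_swap (X Y Z : Π x : M, TangentSpace 𝓘(ℝ, E) x) (x : M) :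
    curvatureField X Y Z x = -curvatureField Y X Z x := by
  simp only [curvatureField]
  rw [mlieBracket_swap_apply, map_neg]
  abel

theorem curvature_swap (u v w : TangentSpace 𝓘(ℝ, E) x) :
    curvature x u v w = -curvature x v u w :=
  curvatureField_swap _ _ _ _

namespace AlmostHermitianStructure

variable {n : ℕ}

/-- `XY - YX - [X, Y]` kills the function `⟨Z, W⟩`. Expanded by metric compatibility, the mixed
terms `⟨∇Z, ∇W⟩` are symmetric in `X`, `Y` and cancel; the curvature terms remain. -/
theorem inner_curvatureField_skew [Nontrivial E] (S : AlmostHermitianStructure E M)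
    (hE : finrank ℝ E = 2 * n)
    (hX : CMDiffAt ∞ (T% X) x) (hY : CMDiffAt ∞ (T% Y) x) (hZ : CMDiffAt ∞ (T% Z) x)
    (hW : CMDiffAt ∞ (T% W) x) :
    inner ℝ (curvatureField X Y Z x) (W x) = -inner ℝ (Z x) (curvatureField X Y W x) := by
  have second {A B : Π x : M, TangentSpace 𝓘(ℝ, E) x} (hB : CMDiffAt ∞ (T% B) x) :
      d% (fun y ↦ d% (fun y ↦ (inner ℝ (Z y) (W y) : ℝ)) y (B y)) x (A x) =
        (inner ℝ (leviCivita E M (fun y ↦ leviCivita E M Z y (B y)) x (A x)) (W x) +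
          inner ℝ (leviCivita E M Z x (B x)) (leviCivita E M W x (A x))) +
        (inner ℝ (leviCivita E M Z x (A x)) (leviCivita E M W x (B x)) +
          inner ℝ (Z x) (leviCivita E M (fun y ↦ leviCivita E M W y (B y)) x (A x))) := by
    have hBZ := S.contMDiffAt_leviCivita hE hB hZ
    have hBW := S.contMDiffAt_leviCivita hE hB hW
    have h : (fun y ↦ d% (fun y ↦ (inner ℝ (Z y) (W y) : ℝ)) y (B y)) =ᶠ[𝓝 x]
        fun y ↦ inner ℝ (leviCivita E M Z y (B y)) (W y) +
          inner ℝ (Z y) (leviCivita E M W y (B y)) := by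
      filter_upwards [hZ.eventually_mdiffAt_section, hW.eventually_mdiffAt_section] with y hZy hWy
      exact leviCivita_inner hZy hWy _
    rw [h.mvfderiv_eq, mvfderiv_fun_add (contMDiffAt_inner hBZ hW).mdiffAt
      (contMDiffAt_inner hZ hBW).mdiffAt, add_apply,
      leviCivita_inner hBZ.mdiffAt_section hW.mdiffAt_section,
      leviCivita_inner hZ.mdiffAt_section hBW.mdiffAt_section]
  have key := mvfderiv_mlieBracket (contMDiffAt_inner hZ hW) hX hY
  rw [second (A := X) hY, second (A := Y) hX,
    leviCivita_inner hZ.mdiffAt_section hW.mdiffAt_section] at key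
  simp only [curvatureField, inner_sub_left, inner_sub_right]
  linarith

/-- The curvature is tensorial in its third argument. -/
theorem curvatureField_congr_right [Nontrivial E] (S : AlmostHermitianStructure E M)
    (hE : finrank ℝ E = 2 * n)
    (hX : CMDiffAt ∞ (T% X) x) (hY : CMDiffAt ∞ (T% Y) x) (hZ : CMDiffAt ∞ (T% Z) x)
    (hW : CMDiffAt ∞ (T% W) x) (hZW : Z x = W x) :
    curvatureField X Y Z x = curvatureField X Y W x := by
  -- By skewness `⟨R Z, V⟩ = -⟨Z, R V⟩`, and the right-hand side involves `Z` only through its value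
  -- at `x`.
  refine ext_inner_left ℝ fun v ↦ ?_
  have hv : CMDiffAt ∞ (T% (extend E v)) x := contMDiffAt_extend 𝓘(ℝ, E) E v
  have h1 := S.inner_curvatureField_skew hE hX hY hv hZ
  have h2 := S.inner_curvatureField_skew hE hX hY hv hW
  rw [hZW] at h1
  simp only [extend_apply_self] at h1 h2
  linarith

theorem inner_curvature_skew [Nontrivial E] (S : AlmostHermitianStructure E M)
    (hE : finrank ℝ E = 2 * n) (u v w z : TangentSpace 𝓘(ℝ, E) x) :
    inner ℝ (curvature x u v w) z = -inner ℝ (curvature x u v z) w := by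
  have h := S.inner_curvatureField_skew hE (contMDiffAt_extend 𝓘(ℝ, E) E u)
    (contMDiffAt_extend 𝓘(ℝ, E) E v) (contMDiffAt_extend 𝓘(ℝ, E) E w)
    (contMDiffAt_extend 𝓘(ℝ, E) E z)
  simp only [extend_apply_self] at h
  rw [real_inner_comm _ w] at h
  exact h

/-- Vanishing torsion reduces the cyclic sum to double Lie brackets, which cancel by the Jacobi
identity. -/
theorem curvature_bianchi (S : AlmostHermitianStructure E M)
    (hE : finrank ℝ E = 2 * n) (u v w : TangentSpace 𝓘(ℝ, E) x) :
    curvature x u v w + curvature x v w u + curvature x w u v = 0 := by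
  have hX : CMDiffAt ∞ (T% (extend E u)) x := contMDiffAt_extend 𝓘(ℝ, E) E u
  have hY : CMDiffAt ∞ (T% (extend E v)) x := contMDiffAt_extend 𝓘(ℝ, E) E v
  have hZ : CMDiffAt ∞ (T% (extend E w)) x := contMDiffAt_extend 𝓘(ℝ, E) E w
  simp only [curvature]
  generalize extend E u = X at *
  generalize extend E v = Y at *
  generalize extend E w = Z at *
  have swap {A B C : Π x : M, TangentSpace 𝓘(ℝ, E) x} (hA : CMDiffAt ∞ (T% A) x)
      (hB : CMDiffAt ∞ (T% B) x) :
      leviCivita E M (fun y ↦ leviCivita E M B y (A y)) x (C x) =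
        leviCivita E M (fun y ↦ leviCivita E M A y (B y)) x (C x) +
          leviCivita E M (mlieBracket 𝓘(ℝ, E) A B) x (C x) := by
    have hBA := (S.contMDiffAt_leviCivita hE hB hA)
    have hbr := hA.mlieBracket hB
    rw [← leviCivita_add hBA.mdiffAt_section hbr.mdiffAt_section,
      leviCivita_congr (S.contMDiffAt_leviCivita hE hA hB).mdiffAt_section
        (hBA.add_section hbr).mdiffAt_section]
    filter_upwards [hA.eventually_mdiffAt_section, hB.eventually_mdiffAt_section] with y hAy hBy
    rw [Pi.add_apply, ← leviCivita_sub_swap hAy hBy, add_sub_cancel]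
  have jac := jacobi_mlieBracket hX hY hZ
  have tXYZ := leviCivita_sub_swap (hX.mlieBracket hY).mdiffAt_section hZ.mdiffAt_section
  have tYZX := leviCivita_sub_swap (hY.mlieBracket hZ).mdiffAt_section hX.mdiffAt_section
  have tXZY := leviCivita_sub_swap (hX.mlieBracket hZ).mdiffAt_section hY.mdiffAt_section
  rw [mlieBracket_swap_apply (V := X), mlieBracket_swap_apply (V := Y), ← tXYZ, ← tYZX,
    ← tXZY] at jac
  simp only [curvatureField]
  rw [swap (C := X) hY hZ, swap (C := Y) hX hZ, swap (C := Z) hX hY,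
    mlieBracket_swap_apply (V := Z) (W := X), map_neg]
  rw [← sub_eq_zero] at jac
  rw [← neg_eq_zero, ← jac]
  abel

/-- Formal consequence of the two skew symmetries and four Bianchi identities, one for each choice
of the vector left out of the cyclic sum. -/
theorem inner_curvature_pair [Nontrivial E] (S : AlmostHermitianStructure E M)
    (hE : finrank ℝ E = 2 * n) (u v w z : TangentSpace 𝓘(ℝ, E) x) :
    inner ℝ (curvature x u v w) z = (inner ℝ (curvature x w z u) v : ℝ) := by
  have skew := S.inner_curvature_skew hE (x := x)
  have swap (a b c d : TangentSpace 𝓘(ℝ, E) x) :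
      inner ℝ (curvature x a b c) d = -(inner ℝ (curvature x b a c) d : ℝ) := by
    rw [curvature_swap, inner_neg_left]
  have bianchi (a b c d : TangentSpace 𝓘(ℝ, E) x) :
      (inner ℝ (curvature x a b c) d + inner ℝ (curvature x b c a) d +
        inner ℝ (curvature x c a b) d : ℝ) = 0 := by
    rw [← inner_add_left, ← inner_add_left, S.curvature_bianchi hE, inner_zero_left]
  have b1 := bianchi u v w z
  have b2 := bianchi v w z u
  have b3 := bianchi w z u v
  have b4 := bianchi z u v w
  linarith [skew u v w z, skew v w u z, skew w u v z, skew w z u v, skew z v w u, skew v w z u,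
    skew z u w v, skew u w z v, skew u v z w, skew z u v w, skew v z u w, swap v z u w,
    swap u w z v, swap z u w v, swap w u v z, swap v z w u, swap u w v z, skew v z w u]

variable {S : AlmostHermitianStructure E M}

/-- `IsKahler` only tests the chosen extensions of tangent vectors. The defect `∇(J Z) - J ∇Z` is
tensorial in `Z`, so this suffices for every differentiable field. -/
theorem IsKahler.leviCivita_J (hS : S.IsKahler) (hZ : MDiffAt (T% Z) x)
    (v : TangentSpace 𝓘(ℝ, E) x) :
    leviCivita E M (fun y ↦ S.J y (Z y)) x v = S.J x (leviCivita E M Z x v) := by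
  have tens : TensorialAt 𝓘(ℝ, E) E (fun Z : Π x : M, TangentSpace 𝓘(ℝ, E) x ↦
      leviCivita E M (fun y ↦ S.J y (Z y)) x v - S.J x (leviCivita E M Z x v)) x := by
    refine ⟨fun {f A} hf hA ↦ ?_, fun {A B} hA hB ↦ ?_⟩
    · have h : (fun y ↦ S.J y ((f • A) y)) = f • fun y ↦ S.J y (A y) := by
        ext y; simp
      rw [h, leviCivita_smul hf (mdiffAt_J hA), leviCivita_smul hf hA]
      simp only [map_add, map_smul, smul_sub]
      abel
    · have h : (fun y ↦ S.J y ((A + B) y)) = (fun y ↦ S.J y (A y)) + fun y ↦ S.J y (B y) := by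
        ext y; simp
      rw [h, leviCivita_add (mdiffAt_J hA) (mdiffAt_J hB), leviCivita_add hA hB]
      simp only [map_add]
      abel
  have h := tens.pointwise hZ (mdifferentiableAt_extend 𝓘(ℝ, E) E (Z x)) (by simp)
  have h0 := hS x v (Z x)
  rw [nablaJ] at h0
  exact sub_eq_zero.1 (h.trans h0)

theorem IsKahler.curvature_J [Nontrivial E] (hS : S.IsKahler) (hE : finrank ℝ E = 2 * n)
    (u v w : TangentSpace 𝓘(ℝ, E) x) :
    curvature x u v (S.J x w) = S.J x (curvature x u v w) := by
  have hX : CMDiffAt ∞ (T% (extend E u)) x := contMDiffAt_extend 𝓘(ℝ, E) E u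
  have hY : CMDiffAt ∞ (T% (extend E v)) x := contMDiffAt_extend 𝓘(ℝ, E) E v
  have hZ : CMDiffAt ∞ (T% (extend E w)) x := contMDiffAt_extend 𝓘(ℝ, E) E w
  simp only [curvature]
  -- The extension of `J w` need not be `J` of the extension of `w`; tensoriality permits the
  -- exchange.
  rw [S.curvatureField_congr_right hE hX hY (contMDiffAt_extend 𝓘(ℝ, E) E (S.J x w))
    (contMDiffAt_J (S := S) hZ) (by simp)]
  generalize extend E u = X at *
  generalize extend E v = Y at *
  generalize extend E w = Z at *
  have second {A B : Π x : M, TangentSpace 𝓘(ℝ, E) x} (hB : CMDiffAt ∞ (T% B) x) :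
      leviCivita E M (fun y ↦ leviCivita E M (fun y ↦ S.J y (Z y)) y (B y)) x (A x) =
        S.J x (leviCivita E M (fun y ↦ leviCivita E M Z y (B y)) x (A x)) := by
    have hBZ := S.contMDiffAt_leviCivita hE hB hZ
    rw [← hS.leviCivita_J hBZ.mdiffAt_section,
      leviCivita_congr (S.contMDiffAt_leviCivita hE hB (contMDiffAt_J hZ)).mdiffAt_section
        (contMDiffAt_J hBZ).mdiffAt_section]
    filter_upwards [hZ.eventually_mdiffAt_section] with y hy
    exact hS.leviCivita_J hy _
  simp only [curvatureField]
  rw [second hX, second hY, hS.leviCivita_J hZ.mdiffAt_section]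
  simp only [map_sub]

end AlmostHermitianStructure

end CurvatureIdentities

/-! ### Linear algebra of complex forms of top degree -/

section ComplexForms

open Classical in
/-- The coefficient `c` with `a (u ∘ k) = c * a u` for alternating maps `a`: the sign of `k` if `k`
is a permutation, and zero otherwise. -/
noncomputable def mapSign {n : ℕ} (k : Fin n → Fin n) : ℝ :=
  if h : Function.Bijective k then ((Equiv.Perm.sign (Equiv.ofBijective k h) : ℤ) : ℝ) else 0

theorem AlternatingMap.map_comp_eq_mapSign_mul {n : ℕ} {V : Type*} [AddCommGroup V] [Module ℝ V]
    (a : V [⋀^Fin n]→ₗ[ℝ] ℂ) (u : Fin n → V) (k : Fin n → Fin n) :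
    a (fun i ↦ u (k i)) = mapSign k * a u := by
  rw [mapSign]
  split_ifs with h
  · have := a.map_perm u (Equiv.ofBijective k h)
    rw [Units.smul_def, zsmul_eq_mul] at this
    simpa [Function.comp_def] using this
  · rw [a.map_eq_zero_of_not_injective _ fun hinj ↦ h ?_]
    · simp
    · exact Finite.injective_iff_bijective.1 hinj.of_comp

variable {E : Type*} [NormedAddCommGroup E] [NormedSpace ℝ E] [FiniteDimensional ℝ E]
  {M : Type*} [TopologicalSpace M] [ChartedSpace E M] [IsManifold 𝓘(ℝ, E) ∞ M]
  [RiemannianBundle (fun x : M ↦ TangentSpace 𝓘(ℝ, E) x)]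

namespace AlmostHermitianStructure

variable {S : AlmostHermitianStructure E M} {n : ℕ} {x : M}
  {a : TangentSpace 𝓘(ℝ, E) x [⋀^Fin n]→ₗ[ℝ] ℂ} {u : Fin n → TangentSpace 𝓘(ℝ, E) x}

theorem map_update_J (ha : ∀ v i, a (Function.update v i (S.J x (v i))) = Complex.I * a v)
    (v : Fin n → TangentSpace 𝓘(ℝ, E) x) (i : Fin n) (z : TangentSpace 𝓘(ℝ, E) x) :
    a (Function.update v i (S.J x z)) = Complex.I * a (Function.update v i z) := by
  have h := ha (Function.update v i z) i
  simpa using h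

theorem IsUnitaryFrame.map_update_eq_sum (hu : S.IsUnitaryFrame x u) (hE : finrank ℝ E = 2 * n)
    (ha : ∀ v i, a (Function.update v i (S.J x (v i))) = Complex.I * a v)
    (v : Fin n → TangentSpace 𝓘(ℝ, E) x) (i : Fin n) (z : TangentSpace 𝓘(ℝ, E) x) :
    a (Function.update v i z) =
      ∑ j, S.hermitian x z (u j) * a (Function.update v i (u j)) := by
  conv_lhs => rw [hu.sum_repr hE z]
  rw [a.map_update_sum]
  refine Finset.sum_congr rfl fun j _ ↦ ?_
  rw [a.map_update_add, a.map_update_smul, a.map_update_smul, map_update_J ha,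
    hermitian, kahlerForm, Complex.mk_eq_add_mul_I, Complex.real_smul, Complex.real_smul]
  ring

/-- A complex multilinear form of top degree is determined by its value on a unitary frame. -/
theorem IsUnitaryFrame.map_update (hu : S.IsUnitaryFrame x u) (hE : finrank ℝ E = 2 * n)
    (ha : ∀ v i, a (Function.update v i (S.J x (v i))) = Complex.I * a v)
    (i : Fin n) (z : TangentSpace 𝓘(ℝ, E) x) :
    a (Function.update u i z) = S.hermitian x z (u i) * a u := by
  rw [hu.map_update_eq_sum hE ha, Finset.sum_eq_single i]
  · simp
  · intro j _ hj
    rw [a.map_update_self u (Ne.symm hj), mul_zero]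
  · simp

theorem IsUnitaryFrame.eq_zero_of_apply_eq_zero (hu : S.IsUnitaryFrame x u)
    (hE : finrank ℝ E = 2 * n)
    (ha : ∀ v i, a (Function.update v i (S.J x (v i))) = Complex.I * a v) (h0 : a u = 0) :
    a = 0 := by
  -- `s` contains the slots not yet filled by frame vectors; the induction expands one of them at a
  -- time.
  have key : ∀ (s : Finset (Fin n)) (v : Fin n → TangentSpace 𝓘(ℝ, E) x),
      (∀ i ∉ s, ∃ j, v i = u j) → a v = 0 := by
    intro s
    induction s using Finset.induction_on with
    | empty =>
      intro v hv
      choose k hk using fun i ↦ hv i (Finset.notMem_empty i)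
      rw [funext hk, a.map_comp_eq_mapSign_mul, h0, mul_zero]
    | insert i s _ ih =>
      intro v hv
      rw [← Function.update_eq_self i v, hu.map_update_eq_sum hE ha]
      refine Finset.sum_eq_zero fun j _ ↦ ?_
      rw [ih, mul_zero]
      intro l hl
      by_cases hli : l = i
      · subst hli; exact ⟨j, by simp⟩
      · rw [Function.update_of_ne hli]
        exact hv l (by simp [hli, hl])
  ext v
  exact key Finset.univ v (by simp)

end AlmostHermitianStructure

namespace SpecialAlmostHermitianStructure

variable {n : ℕ} (S : SpecialAlmostHermitianStructure E M n) {x : M}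

/-- Every component of `Ψ` in the frame is `0` or `±Ψ(u)`, so the unit length condition fixes
`|Ψ(u)|`. -/
theorem normSq_Ψ_mul {u : Fin n → TangentSpace 𝓘(ℝ, E) x}
    (hu : S.toAlmostHermitianStructure.IsUnitaryFrame x u) :
    Complex.normSq (S.Ψ x u) * ∑ k : Fin n → Fin n, mapSign k ^ 2 = n.factorial := by
  have h := S.Ψ_norm x u hu
  have hn : (n.factorial : ℂ) ≠ 0 := by exact_mod_cast n.factorial_ne_zero
  simp only [formHermitian, Complex.mul_conj, AlternatingMap.map_comp_eq_mapSign_mul,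
    Complex.normSq_mul, Complex.normSq_ofReal] at h
  field_simp at h
  have h' : ∑ k : Fin n → Fin n, mapSign k ^ 2 * Complex.normSq (S.Ψ x u) =
      (n.factorial : ℝ) := by
    exact_mod_cast h
  rw [← h', Finset.mul_sum]
  exact Finset.sum_congr rfl fun k _ ↦ by ring

theorem Ψ_ne_zero {u : Fin n → TangentSpace 𝓘(ℝ, E) x}
    (hu : S.toAlmostHermitianStructure.IsUnitaryFrame x u) : S.Ψ x u ≠ 0 := by
  intro h0
  have h := S.normSq_Ψ_mul hu
  rw [h0, map_zero, zero_mul] at h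
  exact n.factorial_ne_zero (by exact_mod_cast h.symm)

/-- What matters is that the value depends neither on the point nor on the frame; the sum itself (it
is `n!`) need not be evaluated. -/
theorem normSq_Ψ {u : Fin n → TangentSpace 𝓘(ℝ, E) x}
    (hu : S.toAlmostHermitianStructure.IsUnitaryFrame x u) :
    Complex.normSq (S.Ψ x u) = n.factorial / ∑ k : Fin n → Fin n, mapSign k ^ 2 := by
  have h := S.normSq_Ψ_mul hu
  refine eq_div_of_mul_eq (fun h0 ↦ ?_) h
  rw [h0, mul_zero] at h
  exact n.factorial_ne_zero (by exact_mod_cast h.symm)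

end SpecialAlmostHermitianStructure

end ComplexForms

/-! ### The covariant derivative of `Ψ` as a tensor -/

section DerivativeOfForm

variable {E : Type*} [NormedAddCommGroup E] [NormedSpace ℝ E] [FiniteDimensional ℝ E]
  {M : Type*} [TopologicalSpace M] [ChartedSpace E M] [IsManifold 𝓘(ℝ, E) ∞ M]

theorem mvfderiv_clm_comp {F F' : Type*} [NormedAddCommGroup F] [NormedSpace ℝ F]
    [NormedAddCommGroup F'] [NormedSpace ℝ F'] (L : F →L[ℝ] F') {f : M → F} {x : M}
    (hf : MDiffAt f x) (v : TangentSpace 𝓘(ℝ, E) x) :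
    d% (fun y ↦ L (f y)) x v = L (d% f x v) := by
  have h := mfderiv_comp_apply x (L.mdifferentiableAt (x := f x)) hf v
  rw [L.mfderiv_eq] at h
  exact h

theorem mvfderiv_fun_sum {F : Type*} [NormedAddCommGroup F] [NormedSpace ℝ F] {ι : Type}
    (s : Finset ι) {f : ι → M → F} {x : M} (hf : ∀ i ∈ s, MDiffAt (f i) x)
    (v : TangentSpace 𝓘(ℝ, E) x) :
    d% (fun y ↦ ∑ i ∈ s, f i y) x v = ∑ i ∈ s, d% (f i) x v := by
  classical
  induction s using Finset.induction_on with
  | empty => simp [mvfderiv_const]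
  | insert i s hi ih =>
    have h1 : MDiffAt (fun y ↦ ∑ i ∈ s, f i y) x := by
      have h : MDiffAt (∑ i ∈ s, f i) x :=
        MDifferentiableAt.sum fun j hj ↦ hf j (Finset.mem_insert_of_mem hj)
      rwa [Finset.sum_fn] at h
    simp only [Finset.sum_insert hi]
    rw [mvfderiv_fun_add (hf i (Finset.mem_insert_self i s)) h1, add_apply,
      ih fun j hj ↦ hf j (Finset.mem_insert_of_mem hj)]

variable [RiemannianBundle (fun x : M ↦ TangentSpace 𝓘(ℝ, E) x)]
  [IsContMDiffRiemannianBundle 𝓘(ℝ, E) ∞ E (fun x : M ↦ TangentSpace 𝓘(ℝ, E) x)]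

theorem Function.update_eval {ι : Type*} [DecidableEq ι]
    (W : ι → Π y : M, TangentSpace 𝓘(ℝ, E) y) (i : ι) (Z : Π y : M, TangentSpace 𝓘(ℝ, E) y)
    (y : M) :
    (fun j ↦ Function.update W i Z j y) = Function.update (fun j ↦ W j y) i (Z y) := by
  ext j
  by_cases h : j = i
  · subst h; simp
  · simp [h]

namespace SpecialAlmostHermitianStructure

variable {n : ℕ} (S : SpecialAlmostHermitianStructure E M n) {x : M}
  {W : Fin n → Π y : M, TangentSpace 𝓘(ℝ, E) y}

/-- Tensoriality is tested on merely differentiable fields, whereas `Ψ` is only assumed smooth on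
smooth ones. Expanding the `W i` in a smooth orthonormal frame leaves differentiable coefficients.
-/
theorem mdiffAt_Ψ (hE : finrank ℝ E = 2 * n) (hW : ∀ i, MDiffAt (T% (W i)) x) :
    MDifferentiableAt 𝓘(ℝ, E) 𝓘(ℝ, ℂ) (fun y ↦ S.Ψ y (fun i ↦ W i y)) x := by
  obtain ⟨U, hU, hUu⟩ := S.exists_smooth_unitary x n hE.ge
  let e : Fin n ⊕ Fin n → Π y : M, TangentSpace 𝓘(ℝ, E) y :=
    Sum.elim U fun i y ↦ S.J y (U i y)
  have he : ∀ k, CMDiffAt ∞ (T% (e k)) x := by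
    rintro (i | i)
    · exact hU i
    · exact AlmostHermitianStructure.contMDiffAt_J (hU i)
  have hsum : MDifferentiableAt 𝓘(ℝ, E) 𝓘(ℝ, ℂ) (∑ r : Fin n → Fin n ⊕ Fin n,
      fun y ↦ (∏ i, (inner ℝ (W i y) (e (r i) y) : ℝ)) • S.Ψ y (fun i ↦ e (r i) y)) x := by
    refine MDifferentiableAt.sum fun r _ ↦ ?_
    have h1 : MDiffAt (∏ i, fun y ↦ (inner ℝ (W i y) (e (r i) y) : ℝ)) x :=
      MDifferentiableAt.prod fun i _ ↦ mdiffAt_inner (hW i) (he (r i)).mdiffAt_section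
    have h2 := MDifferentiableAt.smul h1 (S.contMDiffAt_Ψ x _ fun i ↦ he (r i)).mdiffAt
    rw [Finset.prod_fn] at h2
    exact h2
  refine hsum.congr_of_eventuallyEq ?_
  filter_upwards [hUu] with y hy
  have hexp : ∀ i, W i y = ∑ k, (inner ℝ (W i y) (e k y) : ℝ) • e k y := fun i ↦ by
    conv_lhs => rw [hy.sum_repr hE (W i y)]
    simp [e, Fintype.sum_sum_type, Finset.sum_add_distrib]
  have h1 : S.Ψ y (fun i ↦ W i y) =
      (S.Ψ y).toMultilinearMap fun i ↦ ∑ k, (inner ℝ (W i y) (e k y) : ℝ) • e k y := by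
    rw [← funext hexp]; rfl
  rw [h1, MultilinearMap.map_sum, Finset.sum_apply]
  refine Finset.sum_congr rfl fun r _ ↦ ?_
  rw [MultilinearMap.map_smul_univ]
  rfl

/-- The covariant derivative of `Ψ` computed on vector fields. -/
noncomputable def nablaΨField (W : Fin n → Π y : M, TangentSpace 𝓘(ℝ, E) y) (x : M)
    (v : TangentSpace 𝓘(ℝ, E) x) : ℂ :=
  mvfderiv 𝓘(ℝ, E) (fun y ↦ S.Ψ y (fun i ↦ W i y)) x v
    - ∑ i, S.Ψ x (Function.update (fun i ↦ W i x) i (leviCivita E M (W i) x v))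

theorem nablaΨ_eq_nablaΨField (v : TangentSpace 𝓘(ℝ, E) x)
    (w : Fin n → TangentSpace 𝓘(ℝ, E) x) :
    S.nablaΨ x v w = S.nablaΨField (fun i ↦ extend E (w i)) x v := by
  simp [nablaΨ, nablaΨField]

theorem mdiffAt_update (hW : ∀ i, MDiffAt (T% (W i)) x) {Z : Π y : M, TangentSpace 𝓘(ℝ, E) y}
    (hZ : MDiffAt (T% Z) x) (i j : Fin n) : MDiffAt (T% (Function.update W i Z j)) x := by
  by_cases h : j = i
  · subst h; simpa using hZ
  · simpa [h] using hW j

/-- The `df` term from differentiating `f Ψ(…, Z, …)` cancels the one from the Leibniz rule for `∇_v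
(f Z)` in slot `i`. -/
theorem nablaΨField_tensorial (hE : finrank ℝ E = 2 * n) (hW : ∀ i, MDiffAt (T% (W i)) x)
    (i : Fin n) (v : TangentSpace 𝓘(ℝ, E) x) :
    TensorialAt 𝓘(ℝ, E) E (fun Z ↦ S.nablaΨField (Function.update W i Z) x v) x := by
  have hΨ {Z : Π y : M, TangentSpace 𝓘(ℝ, E) y} (hZ : MDiffAt (T% Z) x) :
      MDifferentiableAt 𝓘(ℝ, E) 𝓘(ℝ, ℂ)
        (fun y ↦ S.Ψ y (Function.update (fun j ↦ W j y) i (Z y))) x := by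
    have := S.mdiffAt_Ψ hE (mdiffAt_update hW hZ i)
    simpa only [Function.update_eval] using this
  refine ⟨fun {f Z} hf hZ ↦ ?_, fun {Z Z'} hZ hZ' ↦ ?_⟩
  · have hsum : ∀ j, S.Ψ x (Function.update (Function.update (fun j ↦ W j x) i ((f • Z) x)) j
        (leviCivita E M (Function.update W i (f • Z) j) x v)) =
        f x • S.Ψ x (Function.update (Function.update (fun j ↦ W j x) i (Z x)) j
          (leviCivita E M (Function.update W i Z j) x v)) +
        if j = i then d% f x v • S.Ψ x (Function.update (fun j ↦ W j x) i (Z x)) else 0 := by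
      intro j
      by_cases h : j = i
      · subst h
        simp [leviCivita_smul hf hZ, AlternatingMap.map_update_add, AlternatingMap.map_update_smul]
      · simp only [Function.update_of_ne h, Function.update_comm (Ne.symm h), Pi.smul_apply',
          AlternatingMap.map_update_smul, if_neg h, add_zero]
    simp only [nablaΨField, Function.update_eval, hsum, Finset.sum_add_distrib,
      Finset.sum_ite_eq', Finset.mem_univ, if_true, ← Finset.smul_sum]
    have hd : (fun y ↦ S.Ψ y (Function.update (fun j ↦ W j y) i ((f • Z) y))) =
        f • fun y ↦ S.Ψ y (Function.update (fun j ↦ W j y) i (Z y)) := by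
      ext y; simp [AlternatingMap.map_update_smul]
    rw [hd, mvfderiv_smul hf (hΨ hZ)]
    simp only [add_apply, smul_apply, ContinuousLinearMap.smulRight_apply, smul_sub]
    abel
  · have hsum : ∀ j, S.Ψ x (Function.update (Function.update (fun j ↦ W j x) i ((Z + Z') x)) j
        (leviCivita E M (Function.update W i (Z + Z') j) x v)) =
        S.Ψ x (Function.update (Function.update (fun j ↦ W j x) i (Z x)) j
          (leviCivita E M (Function.update W i Z j) x v)) +
        S.Ψ x (Function.update (Function.update (fun j ↦ W j x) i (Z' x)) j
          (leviCivita E M (Function.update W i Z' j) x v)) := by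
      intro j
      by_cases h : j = i
      · subst h
        simp [leviCivita_add hZ hZ', AlternatingMap.map_update_add]
      · simp only [Function.update_of_ne h, Function.update_comm (Ne.symm h), Pi.add_apply,
          AlternatingMap.map_update_add]
    simp only [nablaΨField, Function.update_eval, hsum, Finset.sum_add_distrib]
    have hd : (fun y ↦ S.Ψ y (Function.update (fun j ↦ W j y) i ((Z + Z') y))) =
        (fun y ↦ S.Ψ y (Function.update (fun j ↦ W j y) i (Z y))) +
          fun y ↦ S.Ψ y (Function.update (fun j ↦ W j y) i (Z' y)) := by
      ext y; simp [AlternatingMap.map_update_add]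
    rw [hd, mvfderiv_add (hΨ hZ) (hΨ hZ')]
    simp only [add_apply]
    abel

theorem nablaΨField_congr (hE : finrank ℝ E = 2 * n) (hW : ∀ i, MDiffAt (T% (W i)) x)
    {W' : Fin n → Π y : M, TangentSpace 𝓘(ℝ, E) y} (hW' : ∀ i, MDiffAt (T% (W' i)) x)
    (h : ∀ i, W i x = W' i x) (v : TangentSpace 𝓘(ℝ, E) x) :
    S.nablaΨField W x v = S.nablaΨField W' x v := by
  -- The fields are exchanged one slot at a time; `s` is the set of slots already holding `W'`.
  have key : ∀ s : Finset (Fin n), S.nablaΨField (s.piecewise W' W) x v = S.nablaΨField W x v := by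
    intro s
    induction s using Finset.induction_on with
    | empty => simp
    | insert i s hi ih =>
      have hp : ∀ j, MDiffAt (T% (s.piecewise W' W j)) x := fun j ↦ by
        by_cases hj : j ∈ s
        · simpa [hj] using hW' j
        · simpa [hj] using hW j
      rw [← ih, Finset.piecewise_insert]
      conv_rhs => rw [← Function.update_eq_self i (s.piecewise W' W)]
      refine (S.nablaΨField_tensorial hE hp i v).pointwise (hW' i) (hp i) ?_
      simp [hi, h]
  simpa using (key Finset.univ).symm

/-- Frees `∇Ψ` from the chosen extensions, so that it can be computed in a moving unitary frame. -/
theorem nablaΨ_apply_field (hE : finrank ℝ E = 2 * n) (hW : ∀ i, MDiffAt (T% (W i)) x)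
    (v : TangentSpace 𝓘(ℝ, E) x) :
    S.nablaΨ x v (fun i ↦ W i x) = S.nablaΨField W x v := by
  rw [nablaΨ_eq_nablaΨField]
  exact S.nablaΨField_congr hE (fun i ↦ mdifferentiableAt_extend 𝓘(ℝ, E) E _) hW (by simp) v

/-- The function `Ψ(W)` vanishes identically, and the corrections in slots `i` and `j` differ by a
transposition, hence cancel. -/
theorem nablaΨField_eq_zero_of_eq {i j : Fin n} (hij : i ≠ j) (h : W i = W j)
    (v : TangentSpace 𝓘(ℝ, E) x) : S.nablaΨField W x v = 0 := by
  have h0 : (fun y ↦ S.Ψ y (fun i ↦ W i y)) = fun _ ↦ (0 : ℂ) := by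
    ext y
    exact (S.Ψ y).map_eq_zero_of_eq _ (congrFun h y) hij
  rw [nablaΨField, h0, mvfderiv_const, Finset.sum_eq_add i j hij, ← h]
  · have hsw : Function.update (fun k ↦ W k x) j (leviCivita E M (W i) x v) =
        Function.update (fun k ↦ W k x) i (leviCivita E M (W i) x v) ∘ Equiv.swap i j := by
      ext k
      rcases eq_or_ne k i with rfl | hki
      · simp [hij, hij.symm, h]
      rcases eq_or_ne k j with rfl | hkj
      · simp
      · simp [hki, hkj, Equiv.swap_apply_of_ne_of_ne]
    rw [hsw, (S.Ψ x).map_swap _ hij]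
    simp
  · rintro k - ⟨hki, hkj⟩
    refine (S.Ψ x).map_eq_zero_of_eq _ (i := i) (j := j) ?_ hij
    simp [Ne.symm hki, Ne.symm hkj, h]
  · simp
  · simp

/-- The covariant derivative `∇_v Ψ` as an alternating form. -/
noncomputable def nablaΨForm (hE : finrank ℝ E = 2 * n) (x : M) (v : TangentSpace 𝓘(ℝ, E) x) :
    TangentSpace 𝓘(ℝ, E) x [⋀^Fin n]→ₗ[ℝ] ℂ where
  toFun w := S.nablaΨ x v w
  map_update_add' := by
    intro inst w i a b
    obtain rfl : inst = instDecidableEqFin n := Subsingleton.elim _ _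
    have hw : ∀ j, MDiffAt (T% (extend E (w j))) x :=
      fun j ↦ mdifferentiableAt_extend 𝓘(ℝ, E) E (w j)
    have hup (Z : Π y : M, TangentSpace 𝓘(ℝ, E) y) (hZ : MDiffAt (T% Z) x) :
        S.nablaΨ x v (Function.update w i (Z x)) =
          S.nablaΨField (Function.update (fun j ↦ extend E (w j)) i Z) x v := by
      rw [← S.nablaΨ_apply_field hE (mdiffAt_update hw hZ i), Function.update_eval]
      simp
    have ha := mdifferentiableAt_extend 𝓘(ℝ, E) E a
    have hb := mdifferentiableAt_extend 𝓘(ℝ, E) E b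
    have h := (S.nablaΨField_tensorial hE hw i v).add ha hb
    rw [← hup _ ha, ← hup _ hb, ← hup _ (mdifferentiableAt_add_section ha hb)] at h
    simpa using h
  map_update_smul' := by
    intro inst w i c a
    obtain rfl : inst = instDecidableEqFin n := Subsingleton.elim _ _
    have hw : ∀ j, MDiffAt (T% (extend E (w j))) x :=
      fun j ↦ mdifferentiableAt_extend 𝓘(ℝ, E) E (w j)
    have hup (Z : Π y : M, TangentSpace 𝓘(ℝ, E) y) (hZ : MDiffAt (T% Z) x) :
        S.nablaΨ x v (Function.update w i (Z x)) =
          S.nablaΨField (Function.update (fun j ↦ extend E (w j)) i Z) x v := by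
      rw [← S.nablaΨ_apply_field hE (mdiffAt_update hw hZ i), Function.update_eval]
      simp
    have ha := mdifferentiableAt_extend 𝓘(ℝ, E) E a
    have hc : MDiffAt (fun _ : M ↦ c) x := mdifferentiableAt_const
    have h := (S.nablaΨField_tensorial hE hw i v).smul hc ha
    rw [← hup _ ha, ← hup _ (hc.smul_section ha)] at h
    simpa using h
  map_eq_zero_of_eq' w i j h hij := by
    rw [nablaΨ_eq_nablaΨField]
    exact S.nablaΨField_eq_zero_of_eq hij (by rw [h]) v

end SpecialAlmostHermitianStructure

end DerivativeOfForm

/-! ### The intrinsic torsion of a Kähler manifold is `η̂ ⊗ J` -/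

section IntrinsicTorsionOfKahler

variable {E : Type*} [NormedAddCommGroup E] [NormedSpace ℝ E] [FiniteDimensional ℝ E]
  {M : Type*} [TopologicalSpace M] [ChartedSpace E M] [IsManifold 𝓘(ℝ, E) ∞ M]
  [RiemannianBundle (fun x : M ↦ TangentSpace 𝓘(ℝ, E) x)]
  [IsContMDiffRiemannianBundle 𝓘(ℝ, E) ∞ E (fun x : M ↦ TangentSpace 𝓘(ℝ, E) x)]

/-- For an endomorphism commuting with `J`, the trace pairing with `J` is twice the imaginary part
of the complex trace. -/
theorem AlmostHermitianStructure.IsUnitaryFrame.sum_inner_J {S : AlmostHermitianStructure E M}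
    {n : ℕ} {x : M} {u : Fin n → TangentSpace 𝓘(ℝ, E) x} (hu : S.IsUnitaryFrame x u)
    (hE : finrank ℝ E = 2 * n) {ι : Type*} [Fintype ι]
    (e : OrthonormalBasis ι ℝ (TangentSpace 𝓘(ℝ, E) x))
    (B : TangentSpace 𝓘(ℝ, E) x →ₗ[ℝ] TangentSpace 𝓘(ℝ, E) x)
    (hB : ∀ w, B (S.J x w) = S.J x (B w)) :
    ∑ i, inner ℝ (B (e i)) (S.J x (e i)) = 2 * ∑ i, (inner ℝ (B (u i)) (S.J x (u i)) : ℝ) := by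
  have h := hu.sum_inner_apply hE ((S.J x).toLinearMap ∘ₗ B) e
  have hflip (a b : TangentSpace 𝓘(ℝ, E) x) :
      inner ℝ a (S.J x b) = -(inner ℝ b (S.J x a) : ℝ) := by
    rw [← S.inner_J_left, real_inner_comm]
  simp only [LinearMap.comp_apply, ContinuousLinearMap.coe_coe, hB, S.inner_J_J] at h
  simp only [hflip _ (B _), Finset.sum_neg_distrib, ← two_mul,
    ← Finset.mul_sum] at h
  linarith

namespace SpecialAlmostHermitianStructure

variable {n : ℕ} {S : SpecialAlmostHermitianStructure E M n} {x : M}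

/-- Differentiate `Ψ(…, J W_i, …) = i Ψ(W)` and use that `J` is parallel: `∇_v Ψ` keeps the type of
`Ψ`. -/
theorem nablaΨ_update_J (hS : S.IsKahler) (hE : finrank ℝ E = 2 * n)
    (v : TangentSpace 𝓘(ℝ, E) x) (w : Fin n → TangentSpace 𝓘(ℝ, E) x) (i : Fin n) :
    S.nablaΨ x v (Function.update w i (S.J x (w i))) = Complex.I * S.nablaΨ x v w := by
  set W : Fin n → Π y : M, TangentSpace 𝓘(ℝ, E) y := fun j ↦ extend E (w j) with hWdef
  have hW : ∀ j, MDiffAt (T% (W j)) x := fun j ↦ mdifferentiableAt_extend 𝓘(ℝ, E) E (w j)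
  have hWx : (fun j ↦ W j x) = w := by simp [hWdef]
  have hWix : W i x = w i := congrFun hWx i
  have hJ : MDiffAt (T% (fun y ↦ S.J y (W i y))) x :=
    AlmostHermitianStructure.mdiffAt_J (hW i)
  have h1 := S.nablaΨ_apply_field hE (mdiffAt_update hW hJ i) v
  have h2 := S.nablaΨ_apply_field hE hW v
  rw [Function.update_eval, hWx, hWix] at h1
  rw [hWx] at h2
  have hd : (fun y ↦ S.Ψ y (Function.update (fun j ↦ W j y) i (S.J y (W i y)))) =
      fun y ↦ ContinuousLinearMap.mul ℝ ℂ Complex.I (S.Ψ y (fun j ↦ W j y)) := by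
    ext y
    exact S.Ψ_J y (fun j ↦ W j y) i
  have hterm : ∀ j, S.Ψ x (Function.update (Function.update w i (S.J x (w i))) j
      (leviCivita E M (Function.update W i (fun y ↦ S.J y (W i y)) j) x v)) =
      Complex.I * S.Ψ x (Function.update w j (leviCivita E M (W j) x v)) := by
    intro j
    by_cases h : j = i
    · subst h
      rw [Function.update_idem, Function.update_self, hS.leviCivita_J (hW j),
        AlmostHermitianStructure.map_update_J (S.Ψ_J x)]
    · rw [Function.update_of_ne h, Function.update_comm (Ne.symm h),
        AlmostHermitianStructure.map_update_J (S.Ψ_J x)]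
      congr 2
      rw [Function.update_comm h, Function.update_eq_self]
  rw [h1, h2, nablaΨField, nablaΨField, hWx]
  simp only [Function.update_eval, hWx, hWix, hterm, ← Finset.mul_sum, hd]
  rw [mvfderiv_clm_comp _ (S.mdiffAt_Ψ hE hW), ContinuousLinearMap.mul_apply', mul_sub]

/-- On a Kähler manifold `∇Ψ` is a purely imaginary multiple of `Ψ`. -/
theorem exists_nablaΨ_eq (hS : S.IsKahler) (hE : finrank ℝ E = 2 * n) (hn : n ≠ 0)
    (v : TangentSpace 𝓘(ℝ, E) x) :
    ∃ a : ℝ, ∀ w, S.nablaΨ x v w = a • (Complex.I * n * S.Ψ x w) := by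
  obtain ⟨U, hU, hUu⟩ := S.exists_smooth_unitary x n hE.ge
  have hu := hUu.self_of_nhds
  set u : Fin n → TangentSpace 𝓘(ℝ, E) x := fun i ↦ U i x with hudef
  have hΨu := S.Ψ_ne_zero hu
  set c : ℂ := S.nablaΨ x v u / S.Ψ x u with hc
  have hcu : S.nablaΨ x v u = c * S.Ψ x u := by rw [hc, div_mul_cancel₀ _ hΨu]
  -- A complex multilinear form of top degree is determined by its value on one unitary frame, and
  -- `c` was chosen to match there.
  have hform : S.nablaΨForm hE x v - c • S.Ψ x = 0 := by
    refine hu.eq_zero_of_apply_eq_zero hE (fun w i ↦ ?_) ?_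
    · rw [AlternatingMap.sub_apply, AlternatingMap.sub_apply, AlternatingMap.smul_apply,
        AlternatingMap.smul_apply, S.Ψ_J, smul_eq_mul, smul_eq_mul, mul_sub]
      change S.nablaΨ x v _ - _ = Complex.I * S.nablaΨ x v _ - _
      rw [nablaΨ_update_J hS hE]
      ring
    · rw [AlternatingMap.sub_apply, AlternatingMap.smul_apply, smul_eq_mul, sub_eq_zero]
      exact hcu
  have hall : ∀ w, S.nablaΨ x v w = c * S.Ψ x w := fun w ↦ by
    have h := DFunLike.congr_fun hform w
    rw [AlternatingMap.sub_apply, AlternatingMap.smul_apply, smul_eq_mul,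
      AlternatingMap.zero_apply, sub_eq_zero] at h
    exact h
  -- In the frame, `df(v) = (c + ∑ h(∇_v U_i, U_i)) f`. The Hermitian terms are imaginary since
  -- `|U_i| = 1`, and `|f|` is constant, which forces `c` to be imaginary.
  have hre : c.re = 0 := by
    set f : M → ℂ := fun y ↦ S.Ψ y (fun i ↦ U i y) with hf
    have hfd : MDifferentiableAt 𝓘(ℝ, E) 𝓘(ℝ, ℂ) f x :=
      S.mdiffAt_Ψ hE fun i ↦ (hU i).mdiffAt_section
    have hdf : mvfderiv 𝓘(ℝ, E) f x v =
        (c + ∑ i, S.hermitian x (leviCivita E M (U i) x v) (u i)) * f x := by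
      have h := S.nablaΨ_apply_field hE (fun i ↦ (hU i).mdiffAt_section) v
      rw [hcu, nablaΨField, eq_sub_iff_add_eq] at h
      rw [← h, add_mul, Finset.sum_mul]
      congr 1
      exact Finset.sum_congr rfl fun i _ ↦ hu.map_update hE (S.Ψ_J x) i _
    have horth : ∀ i, (S.hermitian x (leviCivita E M (U i) x v) (u i)).re = 0 := fun i ↦ by
      have h1 : (fun y ↦ (inner ℝ (U i y) (U i y) : ℝ)) =ᶠ[𝓝 x] fun _ ↦ 1 := by
        filter_upwards [hUu] with y hy
        simpa using hy.inner_eq i i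
      have h2 := leviCivita_inner (hU i).mdiffAt_section (hU i).mdiffAt_section v
      rw [h1.mvfderiv_eq, mvfderiv_const, real_inner_comm _ (U i x)] at h2
      simp only [zero_apply] at h2
      change inner ℝ (leviCivita E M (U i) x v) (U i x) = (0 : ℝ)
      linarith
    have hnorm : (fun y ↦ (f y).re * (f y).re + (f y).im * (f y).im) =ᶠ[𝓝 x]
        fun _ ↦ n.factorial / ∑ k : Fin n → Fin n, mapSign k ^ 2 := by
      filter_upwards [hUu] with y hy
      exact S.normSq_Ψ hy
    have hred : MDiffAt (fun y ↦ (f y).re) x :=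
      (Complex.reCLM.mdifferentiableAt (x := f x)).comp x hfd
    have himd : MDiffAt (fun y ↦ (f y).im) x :=
      (Complex.imCLM.mdifferentiableAt (x := f x)).comp x hfd
    have hrr : MDiffAt (fun y ↦ (f y).re * (f y).re) x := hred.mul hred
    have hii : MDiffAt (fun y ↦ (f y).im * (f y).im) x := himd.mul himd
    have hD := Filter.EventuallyEq.mvfderiv_eq (E := E) hnorm
    rw [mvfderiv_fun_add hrr hii, mvfderiv_fun_mul hred hred, mvfderiv_fun_mul himd himd,
      mvfderiv_const] at hD
    have h0 := congrArg (fun L ↦ L v) hD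
    have hre := mvfderiv_clm_comp Complex.reCLM hfd v
    have him := mvfderiv_clm_comp Complex.imCLM hfd v
    simp only [Complex.reCLM_apply, Complex.imCLM_apply] at hre him
    simp only [add_apply, smul_apply, smul_eq_mul, hre, him, hdf, zero_apply] at h0
    have hq : (c + ∑ i, S.hermitian x (leviCivita E M (U i) x v) (u i)).re = c.re := by
      simp [Complex.re_sum, horth]
    have hne : Complex.normSq (f x) ≠ 0 := by simpa using hΨu
    rw [Complex.mul_re, Complex.mul_im, hq] at h0
    have : 2 * (c.re * Complex.normSq (f x)) = 0 := by
      rw [Complex.normSq_apply]; linear_combination h0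
    simpa [hne] using this
  refine ⟨c.im / n, fun w ↦ ?_⟩
  have hcI : c = c.im * Complex.I := by
    apply Complex.ext <;> simp [hre]
  have hn' : (n : ℂ) ≠ 0 := by exact_mod_cast hn
  rw [hall, Complex.real_smul]
  conv_lhs => rw [hcI]
  push_cast
  field_simp

theorem endInner_J_self_ne_zero (hE : finrank ℝ E = 2 * n) (hn : n ≠ 0) :
    endInner (S.J x) (S.J x) ≠ 0 := by
  have h : endInner (S.J x) (S.J x) = finrank ℝ E := by
    rw [← finrank_tangentSpace x]
    simp only [endInner, S.inner_J_J]
    simp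
  rw [h, hE]
  exact_mod_cast by omega

theorem endAction_J (w : Fin n → TangentSpace 𝓘(ℝ, E) x) :
    endAction (S.J x) (S.Ψ x) w = -(Complex.I * n * S.Ψ x w) := by
  simp only [endAction, S.Ψ_J, Finset.sum_const, Finset.card_univ, Fintype.card_fin,
    nsmul_eq_mul]
  ring

/-- A complex linear `B` acts on `Ψ` by minus its complex trace. Killing `Ψ` thus makes the trace
zero, and pairing with `J` gives twice its imaginary part. -/
theorem endInner_J_eq_zero (hE : finrank ℝ E = 2 * n)
    {B : TangentSpace 𝓘(ℝ, E) x →L[ℝ] TangentSpace 𝓘(ℝ, E) x} (hB : S.IsSU x B) :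
    endInner (S.J x) B = 0 := by
  obtain ⟨u, hu⟩ := S.exists_unitaryFrame hE x
  obtain ⟨-, hBJ, hBΨ⟩ := hB
  have h := hBΨ u
  simp only [endAction, hu.map_update hE (S.Ψ_J x), ← Finset.sum_mul, neg_eq_zero,
    mul_eq_zero, S.Ψ_ne_zero hu, or_false] at h
  have him := congrArg Complex.im h
  simp only [Complex.im_sum, AlmostHermitianStructure.hermitian,
    AlmostHermitianStructure.kahlerForm, Complex.zero_im] at him
  have htr := hu.sum_inner_J hE (stdOrthonormalBasis ℝ (TangentSpace 𝓘(ℝ, E) x))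
    B.toLinearMap hBJ
  simp only [ContinuousLinearMap.coe_coe, him, mul_zero] at htr
  rw [endInner, ← htr]
  exact Finset.sum_congr rfl fun i _ ↦ real_inner_comm _ _

theorem isSkew_smul_J (a : ℝ) : IsSkew (a • S.J x) := by
  intro v w
  simp only [smul_apply, real_inner_smul_left, real_inner_smul_right, S.inner_J_left]
  ring

/-- Existence: `J` is orthogonal to `su(n)`, commutes with itself, and acts on `Ψ` by `-i n`, which
cancels `∇_v Ψ`. -/
theorem isIntrinsicTorsionAt_smul_J (hS : S.IsKahler) (hE : finrank ℝ E = 2 * n)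
    {v : TangentSpace 𝓘(ℝ, E) x} {a : ℝ}
    (ha : ∀ w, S.nablaΨ x v w = a • (Complex.I * n * S.Ψ x w)) :
    S.IsIntrinsicTorsionAt x v (a • S.J x) := by
  refine ⟨⟨isSkew_smul_J a, fun B hB ↦ ?_⟩, fun w ↦ ?_, fun w ↦ ?_⟩
  · have h := endInner_J_eq_zero hE hB
    simp only [endInner] at h ⊢
    simp only [smul_apply, real_inner_smul_left, ← Finset.mul_sum, h, mul_zero]
  · rw [hS x v w]
    simp
  · have h : endAction (a • S.J x) (S.Ψ x) w = a • endAction (S.J x) (S.Ψ x) w := by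
      simp only [endAction, smul_apply, AlternatingMap.map_update_smul, ← Finset.smul_sum,
        smul_neg]
    rw [h, ha, endAction_J, smul_neg, add_neg_cancel]

/-- Uniqueness: the difference of two solutions lies in `su(n)` and is orthogonal to `su(n)`, hence
to itself. -/
theorem eq_smul_J_of_isIntrinsicTorsionAt (hS : S.IsKahler) (hE : finrank ℝ E = 2 * n)
    {v : TangentSpace 𝓘(ℝ, E) x} {a : ℝ}
    (ha : ∀ w, S.nablaΨ x v w = a • (Complex.I * n * S.Ψ x w))
    {A : TangentSpace 𝓘(ℝ, E) x →L[ℝ] TangentSpace 𝓘(ℝ, E) x}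
    (hA : S.IsIntrinsicTorsionAt x v A) : A = a • S.J x := by
  have hJ := isIntrinsicTorsionAt_smul_J hS hE ha
  have hB : S.IsSU x (A - a • S.J x) := by
    refine ⟨fun p q ↦ ?_, fun w ↦ ?_, fun w ↦ ?_⟩
    · have h1 := hA.1.1 p q
      have h2 := hJ.1.1 p q
      simp only [sub_apply, inner_sub_left, inner_sub_right]
      linarith
    · have h1 := hA.2.1 w
      rw [hS x v w, zero_add, sub_eq_zero] at h1
      simp [h1]
    · have h1 := hA.2.2 w
      have h2 := hJ.2.2 w
      have h3 : endAction (A - a • S.J x) (S.Ψ x) w =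
          endAction A (S.Ψ x) w - endAction (a • S.J x) (S.Ψ x) w := by
        simp only [endAction, sub_apply, AlternatingMap.map_update_sub, Finset.sum_sub_distrib]
        ring
      rw [h3]
      linear_combination h1 - h2
  have h0 : endInner (A - a • S.J x) (A - a • S.J x) = 0 := by
    have h1 := hA.1.2 _ hB
    have h2 := hJ.1.2 _ hB
    have h3 : endInner (A - a • S.J x) (A - a • S.J x) =
        endInner A (A - a • S.J x) - endInner (a • S.J x) (A - a • S.J x) := by
      simp only [endInner, ← Finset.sum_sub_distrib]
      refine Finset.sum_congr rfl fun i _ ↦ ?_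
      rw [← inner_sub_left, ← sub_apply]
    rw [h3, h1, h2, sub_zero]
  rw [endInner, Finset.sum_eq_zero_iff_of_nonneg fun i _ ↦ real_inner_self_nonneg] at h0
  rw [← sub_eq_zero]
  apply ContinuousLinearMap.coe_injective
  refine (stdOrthonormalBasis ℝ (TangentSpace 𝓘(ℝ, E) x)).toBasis.ext fun i ↦ ?_
  simpa using inner_self_eq_zero.1 (h0 i (Finset.mem_univ i))

/-- Existence and uniqueness pin the `epsilon` choice down to `a J`, whose projection to the line of
`J` returns `a`. -/
theorem nablaΨ_eq_etaHat_smul (hS : S.IsKahler) (hE : finrank ℝ E = 2 * n) (hn : n ≠ 0)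
    (v : TangentSpace 𝓘(ℝ, E) x) (w : Fin n → TangentSpace 𝓘(ℝ, E) x) :
    S.nablaΨ x v w = S.etaHat x v • (Complex.I * n * S.Ψ x w) := by
  obtain ⟨a, ha⟩ := exists_nablaΨ_eq hS hE hn v
  have hspec : S.IsIntrinsicTorsionAt x v (S.intrinsicTorsion x v) :=
    Classical.epsilon_spec ⟨_, isIntrinsicTorsionAt_smul_J hS hE ha⟩
  have heta : S.etaHat x v = a := by
    rw [etaHat, eq_smul_J_of_isIntrinsicTorsionAt hS hE ha hspec,
      div_eq_iff (endInner_J_self_ne_zero hE hn)]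
    simp only [endInner, smul_apply, real_inner_smul_left, Finset.mul_sum]
  rw [heta, ha]

end SpecialAlmostHermitianStructure

end IntrinsicTorsionOfKahler

/-! ### The form `n dη̂` as the complex trace of the curvature -/

section RicciForm

variable {E : Type*} [NormedAddCommGroup E] [NormedSpace ℝ E] [FiniteDimensional ℝ E]
  {M : Type*} [TopologicalSpace M] [ChartedSpace E M] [IsManifold 𝓘(ℝ, E) ∞ M]

/-- If `dp = g q` and `dq = -g p` for functions `p`, `q` and a one-form `g`, then `q dg = 0`. -/
theorem oneForm_deriv_mul_eq_zero [Nontrivial E] {p q : M → ℝ}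
    {g : Π y : M, TangentSpace 𝓘(ℝ, E) y → ℝ} {X Y : Π y : M, TangentSpace 𝓘(ℝ, E) y} {x : M}
    (hp : CMDiffAt ∞ p x) (hq : CMDiffAt ∞ q x)
    (hX : CMDiffAt ∞ (T% X) x) (hY : CMDiffAt ∞ (T% Y) x)
    (hdp : ∀ᶠ y in 𝓝 x, ∀ v, d% p y v = g y v * q y)
    (hdq : ∀ᶠ y in 𝓝 x, ∀ v, d% q y v = -(g y v * p y))
    (hgX : MDiffAt (fun y ↦ g y (X y)) x) (hgY : MDiffAt (fun y ↦ g y (Y y)) x) :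
    (d% (fun y ↦ g y (Y y)) x (X x) - d% (fun y ↦ g y (X y)) x (Y x)
      - g x (mlieBracket 𝓘(ℝ, E) X Y x)) * q x = 0 := by
  -- The term `g(B) g(A) p` is symmetric in `A`, `B`, so it drops out of the commutator on `p`.
  have second {A B : Π y : M, TangentSpace 𝓘(ℝ, E) y} (hB : MDiffAt (fun y ↦ g y (B y)) x) :
      d% (fun y ↦ d% p y (B y)) x (A x) =
        d% (fun y ↦ g y (B y)) x (A x) * q x - g x (B x) * (g x (A x) * p x) := by
    have h : (fun y ↦ d% p y (B y)) =ᶠ[𝓝 x] fun y ↦ g y (B y) * q y := by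
      filter_upwards [hdp] with y hy
      exact hy _
    rw [h.mvfderiv_eq, mvfderiv_fun_mul hB hq.mdiffAt]
    simp only [add_apply, smul_apply, smul_eq_mul, hdq.self_of_nhds]
    ring
  have key := mvfderiv_mlieBracket hp hX hY
  rw [second hgX, second hgY, hdp.self_of_nhds] at key
  linarith

variable [RiemannianBundle (fun x : M ↦ TangentSpace 𝓘(ℝ, E) x)]

/-- For `A`, `B` in `u(n)`, the trace of `J A B` vanishes. -/
theorem AlmostHermitianStructure.IsUnitaryFrame.sum_inner_J_eq_zero
    {S : AlmostHermitianStructure E M} {n : ℕ} {x : M} {u a b : Fin n → TangentSpace 𝓘(ℝ, E) x}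
    (hu : S.IsUnitaryFrame x u) (hE : finrank ℝ E = 2 * n)
    (ha : ∀ i j, inner ℝ (a i) (u j) = -(inner ℝ (a j) (u i) : ℝ))
    (haJ : ∀ i j, inner ℝ (a i) (S.J x (u j)) = (inner ℝ (a j) (S.J x (u i)) : ℝ))
    (hb : ∀ i j, inner ℝ (b i) (u j) = -(inner ℝ (b j) (u i) : ℝ))
    (hbJ : ∀ i j, inner ℝ (b i) (S.J x (u j)) = (inner ℝ (b j) (S.J x (u i)) : ℝ)) :
    ∑ i, (inner ℝ (a i) (S.J x (b i)) : ℝ) = 0 := by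
  have hexp : ∀ i, (inner ℝ (a i) (S.J x (b i)) : ℝ) =
      ∑ j, ((inner ℝ (a i) (S.J x (u j)) : ℝ) * inner ℝ (b i) (u j) -
        (inner ℝ (a i) (u j) : ℝ) * inner ℝ (b i) (S.J x (u j))) := fun i ↦ by
    have h : ∀ j, (inner ℝ (u j) (S.J x (b i)) : ℝ) = -inner ℝ (b i) (S.J x (u j)) := fun j ↦ by
      rw [← S.inner_J_left, real_inner_comm]
    conv_lhs => rw [hu.sum_repr hE (a i)]
    rw [sum_inner]
    refine Finset.sum_congr rfl fun j _ ↦ ?_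
    rw [inner_add_left, real_inner_smul_left, real_inner_smul_left, S.inner_J_J, h,
      real_inner_comm (b i) (u j)]
    ring
  simp only [hexp]
  -- Each product pairs a symmetric with a skew matrix, so exchanging `i` and `j` changes the sign
  -- of the sum.
  have hswap : ∑ i, ∑ j, ((inner ℝ (a i) (S.J x (u j)) : ℝ) * inner ℝ (b i) (u j) -
        (inner ℝ (a i) (u j) : ℝ) * inner ℝ (b i) (S.J x (u j))) =
      -∑ i, ∑ j, ((inner ℝ (a i) (S.J x (u j)) : ℝ) * inner ℝ (b i) (u j) -
        (inner ℝ (a i) (u j) : ℝ) * inner ℝ (b i) (S.J x (u j))) := by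
    conv_lhs => rw [Finset.sum_comm]
    rw [← Finset.sum_neg_distrib]
    refine Finset.sum_congr rfl fun i _ ↦ ?_
    rw [← Finset.sum_neg_distrib]
    refine Finset.sum_congr rfl fun j _ ↦ ?_
    rw [ha j i, haJ j i, hb j i, hbJ j i]
    ring
  linarith

variable [IsContMDiffRiemannianBundle 𝓘(ℝ, E) ∞ E (fun x : M ↦ TangentSpace 𝓘(ℝ, E) x)]

namespace AlmostHermitianStructure

variable {S : AlmostHermitianStructure E M} {n : ℕ} {x : M}
  {U : Fin n → Π y : M, TangentSpace 𝓘(ℝ, E) y}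

/-- Together with `inner_leviCivita_J_symm`, this says that the connection matrix of a unitary frame
lies in `u(n)`. -/
theorem inner_leviCivita_skew (hU : ∀ i, MDiffAt (T% (U i)) x)
    (hUu : ∀ᶠ y in 𝓝 x, S.IsUnitaryFrame y (fun i ↦ U i y)) (v : TangentSpace 𝓘(ℝ, E) x)
    (i j : Fin n) :
    inner ℝ (leviCivita E M (U i) x v) (U j x) =
      -(inner ℝ (leviCivita E M (U j) x v) (U i x) : ℝ) := by
  have h1 : (fun y ↦ (inner ℝ (U i y) (U j y) : ℝ)) =ᶠ[𝓝 x] fun _ ↦ if i = j then 1 else 0 := by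
    filter_upwards [hUu] with y hy
    exact hy.inner_eq i j
  have h2 := leviCivita_inner (hU i) (hU j) v
  rw [h1.mvfderiv_eq, mvfderiv_const, real_inner_comm _ (U i x), zero_apply] at h2
  linarith

theorem inner_leviCivita_J_symm (hS : S.IsKahler) (hU : ∀ i, MDiffAt (T% (U i)) x)
    (hUu : ∀ᶠ y in 𝓝 x, S.IsUnitaryFrame y (fun i ↦ U i y)) (v : TangentSpace 𝓘(ℝ, E) x)
    (i j : Fin n) :
    inner ℝ (leviCivita E M (U i) x v) (S.J x (U j x)) =
      (inner ℝ (leviCivita E M (U j) x v) (S.J x (U i x)) : ℝ) := by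
  have h1 : (fun y ↦ (inner ℝ (U i y) (S.J y (U j y)) : ℝ)) =ᶠ[𝓝 x] fun _ ↦ 0 := by
    filter_upwards [hUu] with y hy
    exact hy.inner_J_eq i j
  have h2 := leviCivita_inner (hU i) (mdiffAt_J (S := S) (hU j)) v
  rw [h1.mvfderiv_eq, mvfderiv_const, hS.leviCivita_J (hU j), zero_apply] at h2
  have h3 := S.inner_J_left (U i x) (leviCivita E M (U j) x v)
  rw [real_inner_comm] at h3
  linarith

variable (S U) in
/-- The connection form of the complex determinant line in the unitary frame `U`. -/
noncomputable def traceForm (x : M) (v : TangentSpace 𝓘(ℝ, E) x) : ℝ :=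
  ∑ i, inner ℝ (leviCivita E M (U i) x v) (S.J x (U i x))

theorem contMDiffAt_traceForm (hE : finrank ℝ E = 2 * n) (hU : ∀ i, CMDiffAt ∞ (T% (U i)) x)
    {X : Π y : M, TangentSpace 𝓘(ℝ, E) y} (hX : CMDiffAt ∞ (T% X) x) :
    CMDiffAt ∞ (fun y ↦ S.traceForm U y (X y)) x := by
  have h : CMDiffAt ∞ (fun y ↦ ∑ i : Fin n,
      (inner ℝ (leviCivita E M (U i) y (X y)) (S.J y (U i y)) : ℝ)) x :=
    contMDiffAt_finsetSum fun i _ ↦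
      contMDiffAt_inner (S.contMDiffAt_leviCivita hE hX (hU i)) (contMDiffAt_J (hU i))
  exact h

/-- The traced structure equation: the terms quadratic in the connection matrix vanish under the
trace, leaving the curvature. -/
theorem traceForm_deriv (hS : S.IsKahler) (hE : finrank ℝ E = 2 * n)
    (hU : ∀ i, CMDiffAt ∞ (T% (U i)) x)
    (hUu : ∀ᶠ y in 𝓝 x, S.IsUnitaryFrame y (fun i ↦ U i y))
    {X Y : Π y : M, TangentSpace 𝓘(ℝ, E) y}
    (hX : CMDiffAt ∞ (T% X) x) (hY : CMDiffAt ∞ (T% Y) x) :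
    d% (fun y ↦ S.traceForm U y (Y y)) x (X x) - d% (fun y ↦ S.traceForm U y (X y)) x (Y x)
      - S.traceForm U x (mlieBracket 𝓘(ℝ, E) X Y x) =
      -∑ i, inner ℝ (curvatureField X Y (U i) x) (S.J x (U i x)) := by
  have hUd : ∀ i, MDiffAt (T% (U i)) x := fun i ↦ (hU i).mdiffAt_section
  have second {A B : Π y : M, TangentSpace 𝓘(ℝ, E) y} (hB : CMDiffAt ∞ (T% B) x) :
      d% (fun y ↦ S.traceForm U y (B y)) x (A x) =
        ∑ i, (inner ℝ (leviCivita E M (fun y ↦ leviCivita E M (U i) y (B y)) x (A x))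
          (S.J x (U i x)) : ℝ) := by
    have hBU := fun i ↦ S.contMDiffAt_leviCivita hE hB (hU i)
    have hzero := hUu.self_of_nhds.sum_inner_J_eq_zero hE
      (inner_leviCivita_skew hUd hUu (B x)) (inner_leviCivita_J_symm hS hUd hUu (B x))
      (inner_leviCivita_skew hUd hUu (A x)) (inner_leviCivita_J_symm hS hUd hUu (A x))
    simp only [traceForm]
    rw [mvfderiv_fun_sum Finset.univ fun i _ ↦
      (contMDiffAt_inner (hBU i) (contMDiffAt_J (S := S) (hU i))).mdiffAt]
    refine Eq.trans ?_ (add_zero _)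
    rw [← hzero, ← Finset.sum_add_distrib]
    refine Finset.sum_congr rfl fun i _ ↦ ?_
    rw [leviCivita_inner (hBU i).mdiffAt_section (mdiffAt_J (S := S) (hUd i)),
      hS.leviCivita_J (hUd i)]
  rw [second hX, second hY, traceForm, ← Finset.sum_sub_distrib, ← Finset.sum_sub_distrib,
    ← Finset.sum_neg_distrib]
  refine Finset.sum_congr rfl fun i _ ↦ ?_
  simp only [curvatureField, inner_sub_left]
  ring

end AlmostHermitianStructure

namespace SpecialAlmostHermitianStructure

variable {n : ℕ} {S : SpecialAlmostHermitianStructure E M n} {x : M}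
  {U : Fin n → Π y : M, TangentSpace 𝓘(ℝ, E) y}

/-- `∇_v Ψ` contributes `i n η̂(v)`, and slot `i` contributes `h(∇_v U_i, U_i)`, which is imaginary
because `U_i` has unit length. -/
theorem mvfderiv_Ψ_unitary (hS : S.IsKahler) (hE : finrank ℝ E = 2 * n) (hn : n ≠ 0)
    (hU : ∀ i, MDiffAt (T% (U i)) x)
    (hUu : ∀ᶠ y in 𝓝 x, S.IsUnitaryFrame y (fun i ↦ U i y)) (v : TangentSpace 𝓘(ℝ, E) x) :
    mvfderiv 𝓘(ℝ, E) (fun y ↦ S.Ψ y (fun i ↦ U i y)) x v =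
      (n * S.etaHat x v + S.traceForm U x v : ℝ) * (Complex.I * S.Ψ x (fun i ↦ U i x)) := by
  have h := S.nablaΨ_apply_field hE hU v
  rw [nablaΨ_eq_etaHat_smul hS hE hn, nablaΨField, eq_sub_iff_add_eq] at h
  rw [← h]
  have hherm : ∀ i, S.hermitian x (leviCivita E M (U i) x v) (U i x) =
      (inner ℝ (leviCivita E M (U i) x v) (S.J x (U i x)) : ℝ) * Complex.I := fun i ↦ by
    have h0 := AlmostHermitianStructure.inner_leviCivita_skew hU hUu v i i
    have h1 : inner ℝ (leviCivita E M (U i) x v) (U i x) = (0 : ℝ) := by linarith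
    apply Complex.ext <;>
      simp [AlmostHermitianStructure.hermitian, AlmostHermitianStructure.kahlerForm, h1]
  simp only [hUu.self_of_nhds.map_update hE (S.Ψ_J x), hherm, ← Finset.sum_mul,
    AlmostHermitianStructure.traceForm, Complex.real_smul]
  push_cast
  ring

/-- On a Kähler manifold `n dη̂(v, w)` is the complex trace of the curvature. -/
theorem sum_inner_curvature_J [Nontrivial E] (hS : S.IsKahler) (hE : finrank ℝ E = 2 * n)
    (hn : n ≠ 0) (v w : TangentSpace 𝓘(ℝ, E) x) :
    ∃ u : Fin n → TangentSpace 𝓘(ℝ, E) x, S.IsUnitaryFrame x u ∧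
      ∑ i, inner ℝ (curvature x v w (u i)) (S.J x (u i)) = n * oneFormDeriv S.etaHat x v w := by
  obtain ⟨U, hU, hUu⟩ := S.exists_smooth_unitary x n hE.ge
  have hu := hUu.self_of_nhds
  refine ⟨fun i ↦ U i x, hu, ?_⟩
  set f : M → ℂ := fun y ↦ S.Ψ y (fun i ↦ U i y) with hf
  set p : M → ℝ := fun y ↦ (f y).re with hpdef
  set q : M → ℝ := fun y ↦ (f y).im with hqdef
  set g : Π y : M, TangentSpace 𝓘(ℝ, E) y → ℝ :=
    fun y v ↦ n * S.etaHat y v + S.traceForm U y v with hg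
  have hfs : ContMDiffAt 𝓘(ℝ, E) 𝓘(ℝ, ℂ) ∞ f x := S.contMDiffAt_Ψ x U hU
  have hp : CMDiffAt ∞ p x := (Complex.reCLM.contMDiff.contMDiffAt (x := f x)).comp x hfs
  have hq : CMDiffAt ∞ q x := (Complex.imCLM.contMDiff.contMDiffAt (x := f x)).comp x hfs
  have hUe : ∀ᶠ y in 𝓝 x, ∀ i, MDiffAt (T% (U i)) y :=
    Filter.eventually_all.2 fun i ↦ (hU i).eventually_mdiffAt_section
  have hdf : ∀ᶠ y in 𝓝 x, ∀ v, mvfderiv 𝓘(ℝ, E) f y v = g y v * (Complex.I * f y) := by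
    filter_upwards [hUe, hUu.eventually_nhds] with y hy hyu v
    exact mvfderiv_Ψ_unitary hS hE hn hy hyu v
  have hdp : ∀ᶠ y in 𝓝 x, ∀ v, d% p y v = -(g y v * q y) := by
    filter_upwards [hdf, hfs.eventually_mdiffAt] with y hy hfy v
    have h := mvfderiv_clm_comp Complex.reCLM hfy v
    simp only [Complex.reCLM_apply] at h
    rw [h, hy]
    simp [hqdef]
  have hdq : ∀ᶠ y in 𝓝 x, ∀ v, d% q y v = g y v * p y := by
    filter_upwards [hdf, hfs.eventually_mdiffAt] with y hy hfy v
    have h := mvfderiv_clm_comp Complex.imCLM hfy v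
    simp only [Complex.imCLM_apply] at h
    rw [h, hy]
    simp [hpdef]
  have hpos : 0 < p x * p x + q x * q x := by
    have h := Complex.normSq_pos.2 (S.Ψ_ne_zero hu)
    rwa [Complex.normSq_apply] at h
  have hN : CMDiffAt ∞ (fun y ↦ p y * p y + q y * q y) x := (hp.mul hp).add (hq.mul hq)
  -- `η̂` is defined by pointwise choice, so its smoothness has to be recovered from `f = p + i q`:
  -- near `x`, `g = (p dq - q dp) / (p² + q²)`.
  have hgs {X : Π y : M, TangentSpace 𝓘(ℝ, E) y} (hX : CMDiffAt ∞ (T% X) x) :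
      CMDiffAt ∞ (fun y ↦ g y (X y)) x := by
    have h1 : CMDiffAt ∞ (fun y ↦ (p y * d% q y (X y) - q y * d% p y (X y)) *
        (p y * p y + q y * q y)⁻¹) x :=
      ((hp.mul (hq.mvfderiv_apply hX)).sub (hq.mul (hp.mvfderiv_apply hX))).mul
        (hN.inv₀ hpos.ne')
    refine h1.congr_of_eventuallyEq ?_
    filter_upwards [hdp, hdq, hN.continuousAt.eventually (lt_mem_nhds hpos)] with y h2 h3 h4
    rw [h2, h3, ← div_eq_mul_inv, eq_div_iff h4.ne']
    ring
  have hX : CMDiffAt ∞ (T% (extend E v)) x := contMDiffAt_extend 𝓘(ℝ, E) E v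
  have hY : CMDiffAt ∞ (T% (extend E w)) x := contMDiffAt_extend 𝓘(ℝ, E) E w
  -- Closedness of `d(arg f)` without a logarithm: `p dg = 0` and, with `-g` for `g`, also `q dg =
  -- 0`, while `p` and `q` do not both vanish at `x`.
  have hclosed : d% (fun y ↦ g y (extend E w y)) x v - d% (fun y ↦ g y (extend E v y)) x w
      - g x (mlieBracket 𝓘(ℝ, E) (extend E v) (extend E w) x) = 0 := by
    have h1 := oneForm_deriv_mul_eq_zero hq hp hX hY hdq hdp (hgs hX).mdiffAt (hgs hY).mdiffAt
    have hdp' : ∀ᶠ y in 𝓝 x, ∀ v, d% p y v = (-g y v) * q y :=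
      hdp.mono fun y hy v ↦ by rw [hy, neg_mul]
    have hdq' : ∀ᶠ y in 𝓝 x, ∀ v, d% q y v = -((-g y v) * p y) :=
      hdq.mono fun y hy v ↦ by rw [hy, neg_mul, neg_neg]
    have h2 := oneForm_deriv_mul_eq_zero (g := fun y v ↦ -g y v) hp hq hX hY hdp' hdq'
      (hgs hX).neg.mdiffAt (hgs hY).neg.mdiffAt
    have hneg (Z : Π y : M, TangentSpace 𝓘(ℝ, E) y) (v : TangentSpace 𝓘(ℝ, E) x) :
        d% (fun y ↦ -g y (Z y)) x v = -d% (fun y ↦ g y (Z y)) x v := by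
      exact DFunLike.congr_fun (mvfderiv_neg (g := fun y ↦ g y (Z y))) v
    simp only [extend_apply_self, hneg] at h1 h2
    by_contra hne
    have hp0 := (mul_eq_zero.1 h1).resolve_left hne
    have hq0 := (mul_eq_zero.1 h2).resolve_left fun h ↦ hne (by linarith)
    rw [hp0, hq0] at hpos
    simp at hpos
  have heta {Z : Π y : M, TangentSpace 𝓘(ℝ, E) y} (hZ : CMDiffAt ∞ (T% Z) x)
      (z : TangentSpace 𝓘(ℝ, E) x) :
      n * d% (fun y ↦ S.etaHat y (Z y)) x z =
        d% (fun y ↦ g y (Z y)) x z - d% (fun y ↦ S.traceForm U y (Z y)) x z := by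
    have ht := AlmostHermitianStructure.contMDiffAt_traceForm (S := S.toAlmostHermitianStructure)
      hE hU hZ
    have hn' : (n : ℝ) ≠ 0 := by exact_mod_cast hn
    have h : (fun y ↦ S.etaHat y (Z y)) =
        fun y ↦ (n : ℝ)⁻¹ * (g y (Z y) - S.traceForm U y (Z y)) := by
      ext y
      simp only [hg]
      field_simp
      ring
    have hd : MDiffAt (fun y ↦ g y (Z y) - S.traceForm U y (Z y)) x :=
      ((hgs hZ).sub ht).mdiffAt
    have h3 := mvfderiv_clm_comp (ContinuousLinearMap.mul ℝ ℝ (n : ℝ)⁻¹) hd z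
    simp only [ContinuousLinearMap.mul_apply'] at h3
    rw [h, h3, mvfderiv_fun_sub (hgs hZ).mdiffAt ht.mdiffAt, sub_apply]
    field_simp
  have htr := AlmostHermitianStructure.traceForm_deriv hS hE hU hUu hX hY
  have hcurv : ∀ i, curvature x v w (U i x) = curvatureField (extend E v) (extend E w) (U i) x :=
    fun i ↦ S.curvatureField_congr_right hE hX hY (contMDiffAt_extend 𝓘(ℝ, E) E _) (hU i)
      (by simp)
  simp only [extend_apply_self] at htr
  simp only [hcurv]
  have h1 := heta hX w
  have h2 := heta hY v
  rw [oneFormDeriv, mul_sub, mul_sub, h1, h2]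
  have h3 : g x (mlieBracket 𝓘(ℝ, E) (extend E v) (extend E w) x) =
    n * S.etaHat x (mlieBracket 𝓘(ℝ, E) (extend E v) (extend E w) x) +
      S.traceForm U x (mlieBracket 𝓘(ℝ, E) (extend E v) (extend E w) x) := rfl
  linarith

end SpecialAlmostHermitianStructure

end RicciForm

/-! ### Ricci curvature of Kähler metrics -/

section RicciOfKahler

variable {E : Type*} [NormedAddCommGroup E] [NormedSpace ℝ E] [FiniteDimensional ℝ E]
  {M : Type*} [TopologicalSpace M] [ChartedSpace E M] [IsManifold 𝓘(ℝ, E) ∞ M]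
  [RiemannianBundle (fun x : M ↦ TangentSpace 𝓘(ℝ, E) x)]
  [IsContMDiffRiemannianBundle 𝓘(ℝ, E) ∞ E (fun x : M ↦ TangentSpace 𝓘(ℝ, E) x)]

namespace AlmostHermitianStructure

variable {S : AlmostHermitianStructure E M} {n : ℕ} {x : M}

/-- `J` is skew with inverse `-J`, so the left-hand side is the trace of the conjugate `J⁻¹ A J`. -/
theorem sum_inner_J_apply_J (A : TangentSpace 𝓘(ℝ, E) x →ₗ[ℝ] TangentSpace 𝓘(ℝ, E) x)
    {ι : Type*} [Fintype ι] (e : OrthonormalBasis ι ℝ (TangentSpace 𝓘(ℝ, E) x)) :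
    ∑ i, inner ℝ (S.J x (e i)) (A (S.J x (e i))) = ∑ i, (inner ℝ (e i) (A (e i)) : ℝ) := by
  have hJ : (S.J x).toLinearMap * (S.J x).toLinearMap = -1 := by
    ext v; simp [S.J_J]
  have h : ∀ i, (inner ℝ (S.J x (e i)) (A (S.J x (e i))) : ℝ) =
      inner ℝ (e i) ((-((S.J x).toLinearMap * (A * (S.J x).toLinearMap))) (e i)) := fun i ↦ by
    simp [S.inner_J_left]
  simp only [h]
  rw [← A.trace_eq_sum_inner e, ← LinearMap.trace_eq_sum_inner _ e, map_neg,
    LinearMap.trace_mul_comm, mul_assoc, hJ]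
  simp

/-- The curvature operator `R_{v,w}`. -/
noncomputable def curvatureOperator [Nontrivial E] (S : AlmostHermitianStructure E M)
    (hE : finrank ℝ E = 2 * n) (v w : TangentSpace 𝓘(ℝ, E) x) :
    TangentSpace 𝓘(ℝ, E) x →ₗ[ℝ] TangentSpace 𝓘(ℝ, E) x where
  toFun z := curvature x v w z
  map_add' a b := ext_inner_right ℝ fun z ↦ by
    rw [inner_add_left]
    simp only [S.inner_curvature_skew hE v w _ z, inner_add_right, neg_add]
  map_smul' c a := ext_inner_right ℝ fun z ↦ by
    rw [RingHom.id_apply, real_inner_smul_left]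
    simp only [S.inner_curvature_skew hE v w _ z, real_inner_smul_right, mul_neg]

/-- The Jacobi-type operator `z ↦ R_{v,z} w`, whose trace is `Ric(v, w)`. -/
noncomputable def ricciOperator [Nontrivial E] (S : AlmostHermitianStructure E M)
    (hE : finrank ℝ E = 2 * n) (v w : TangentSpace 𝓘(ℝ, E) x) :
    TangentSpace 𝓘(ℝ, E) x →ₗ[ℝ] TangentSpace 𝓘(ℝ, E) x where
  toFun z := curvature x v z w
  -- Pair symmetry moves the variable out of the curvature into a slot of the scalar product, where
  -- linearity is evident.
  map_add' a b := ext_inner_right ℝ fun z ↦ by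
    rw [inner_add_left]
    simp only [S.inner_curvature_pair hE v _ w z, inner_add_right]
  map_smul' c a := ext_inner_right ℝ fun z ↦ by
    rw [RingHom.id_apply, real_inner_smul_left]
    simp only [S.inner_curvature_pair hE v _ w z, real_inner_smul_right]

theorem IsKahler.starRicci_eq [Nontrivial E] (hS : S.IsKahler) (hE : finrank ℝ E = 2 * n)
    (v w : TangentSpace 𝓘(ℝ, E) x) : S.starRicci x v w = ricci x v w := by
  simp only [starRicci, ricci, hS.curvature_J hE, S.inner_J_J]

/-- Trace over `J e_i` instead of `e_i`, then apply pair symmetry and `R J = J R`. Pair symmetry is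
what interchanges `v` and `w`. -/
theorem IsKahler.ricci_J_J [Nontrivial E] (hS : S.IsKahler) (hE : finrank ℝ E = 2 * n)
    (v w : TangentSpace 𝓘(ℝ, E) x) : ricci x (S.J x w) (S.J x v) = ricci x v w := by
  have h := sum_inner_J_apply_J (S := S) (S.ricciOperator hE (S.J x w) (S.J x v))
    (stdOrthonormalBasis ℝ (TangentSpace 𝓘(ℝ, E) x))
  simp only [ricciOperator, LinearMap.coe_mk, AddHom.coe_mk] at h
  simp only [ricci]
  simp only [fun i ↦ real_inner_comm (stdOrthonormalBasis ℝ (TangentSpace 𝓘(ℝ, E) x) i)]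
  rw [← h]
  refine Finset.sum_congr rfl fun i _ ↦ ?_
  rw [hS.curvature_J hE, S.inner_J_J, real_inner_comm, S.inner_curvature_pair hE,
    hS.curvature_J hE, S.inner_J_J, real_inner_comm]

/-- The Ricci form is the trace of the curvature against `J`. -/
theorem IsKahler.sum_inner_curvature_J_eq [Nontrivial E] (hS : S.IsKahler)
    (hE : finrank ℝ E = 2 * n) (v w : TangentSpace 𝓘(ℝ, E) x) :
    ∑ i, inner ℝ (curvature x v (S.J x w) (stdOrthonormalBasis ℝ (TangentSpace 𝓘(ℝ, E) x) i))
      (S.J x (stdOrthonormalBasis ℝ (TangentSpace 𝓘(ℝ, E) x) i)) = 2 * ricci x v w := by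
  rw [two_mul]
  conv_rhs => arg 2; rw [← hS.ricci_J_J hE]
  simp only [ricci]
  rw [← Finset.sum_add_distrib]
  refine Finset.sum_congr rfl fun i _ ↦ ?_
  generalize (stdOrthonormalBasis ℝ (TangentSpace 𝓘(ℝ, E) x)) i = e
  -- Bianchi for `v`, `J w`, `e` paired with `J e`: one term gives the summand of `Ric(v, w)`, the
  -- other that of `Ric(J w, J v)`.
  have hb := congrArg (fun z ↦ (inner ℝ z (S.J x e) : ℝ)) (S.curvature_bianchi hE v (S.J x w) e)
  simp only [inner_add_left, inner_zero_left] at hb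
  rw [curvature_swap e v, hS.curvature_J hE v e, inner_neg_left, S.inner_J_J] at hb
  rw [hS.curvature_J hE (S.J x w) e v, S.inner_J_left]
  linarith

end AlmostHermitianStructure

namespace SpecialAlmostHermitianStructure

theorem ricci_eq_oneFormDeriv_etaHat [Nontrivial E] {n : ℕ}
    {S : SpecialAlmostHermitianStructure E M n} (hS : S.IsKahler) (hE : finrank ℝ E = 2 * n)
    (hn : n ≠ 0) {x : M} (v w : TangentSpace 𝓘(ℝ, E) x) :
    ricci x v w = n * oneFormDeriv S.etaHat x v (S.J x w) := by
  obtain ⟨u, hu, h⟩ := sum_inner_curvature_J hS hE hn v (S.J x w)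
  have h1 := hu.sum_inner_J hE (stdOrthonormalBasis ℝ (TangentSpace 𝓘(ℝ, E) x))
    (S.curvatureOperator hE v (S.J x w)) (hS.curvature_J hE v (S.J x w))
  have h2 := hS.sum_inner_curvature_J_eq hE v w
  simp only [AlmostHermitianStructure.curvatureOperator, LinearMap.coe_mk, AddHom.coe_mk] at h1
  linarith

end SpecialAlmostHermitianStructure

end RicciOfKahler

/-! ### The main theorem -/

theorem theorem3p4 {n : ℕ} (hn : 2 ≤ n)
    {E : Type*} [NormedAddCommGroup E] [NormedSpace ℝ E] [FiniteDimensional ℝ E]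
    (hE : Module.finrank ℝ E = 2 * n)
    {M : Type*} [TopologicalSpace M] [T2Space M] [SecondCountableTopology M]
    [ChartedSpace E M] [IsManifold 𝓘(ℝ, E) ∞ M]
    [RiemannianBundle (fun x : M ↦ TangentSpace 𝓘(ℝ, E) x)]
    [IsContMDiffRiemannianBundle 𝓘(ℝ, E) ∞ E (fun x : M ↦ TangentSpace 𝓘(ℝ, E) x)]
    (S : SpecialAlmostHermitianStructure E M n) (hS : S.IsKahler) :
    (∀ (x : M) (v w : TangentSpace 𝓘(ℝ, E) x), S.starRicci x v w = ricci x v w) ∧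
    (∀ c : ℝ, c ≠ 0 →
      (∀ (x : M) (v w : TangentSpace 𝓘(ℝ, E) x),
        oneFormDeriv S.etaHat x v w = c * S.kahlerForm x v w) → IsEinstein E M) ∧
    ((∀ (x : M) (v w : TangentSpace 𝓘(ℝ, E) x), oneFormDeriv S.etaHat x v w = 0) →
      IsRicciFlat E M) := by
  have : Nontrivial E := Module.nontrivial_of_finrank_pos (R := ℝ) (by omega)
  have hn0 : n ≠ 0 := by omega
  -- The Einstein constant is `-(n c)`: `Ric(v, w) = n c ω(v, J w)` and `J² = -1`.
  refine ⟨fun x v w ↦ hS.starRicci_eq hE v w, fun c _ h ↦ ⟨-(n * c), fun x v w ↦ ?_⟩,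
    fun h x v w ↦ ?_⟩
  · rw [SpecialAlmostHermitianStructure.ricci_eq_oneFormDeriv_etaHat hS hE hn0, h,
      AlmostHermitianStructure.kahlerForm, S.J_J, inner_neg_right]
    ring
  · rw [SpecialAlmostHermitianStructure.ricci_eq_oneFormDeriv_etaHat hS hE hn0, h, mul_zero]
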